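/- Let $\mathcal V$ be a complete and cocomplete symmetric monoidal closed category with unit $I$, and let $\mathcal A$ be a small right closed monoidal $\mathcal V$-category. That is, $\mathcal A$ is a $\mathcal V$-category with a $\mathcal V$-functor $\otimes:\mathcal A\otimes\mathcal A\to\mathcal A$, a unit object $I$ and coherent $\mathcal V$-natural associativity and unit isomorphisms $a,\ell,r$, and for all objects $X,Y$ of $\mathcal A$ there are an object $Y^X$ and a morphism $e_r: X\otimes Y^X\to Y$ inducing isomorphisms $\mathcal A(B,Y^X)\cong\mathcal A(X\otimes B,Y)$ in $\mathcal V$ for all $B$. Then $(X,Y)\mapsto Y^X$ is a $\mathcal V$-functor $\mathcal A^{\mathrm{op}}\otimes\mathcal A\to\mathcal A$. Write $d_r: Y\to (X\otimes Y)^X$ for the morphism corresponding to the identity of $X\otimes Y$. A *left Tambara module* on $\mathcal A$ is a $\mathcal V$-functor $T:\mathcal A^{\mathrm{op}}\otimes\mathcal A\to\mathcal V$ together with morphisms $$\alpha_l(A,X,Y):T(X,Y)\to T(A\otimes X,A\otimes Y),$$ $\mathcal V$-natural in each of $A$, $X$ and $Y$, such that $$T(1,\ell_Y)\circ\alpha_l(I,X,Y)=T(\ell_X,1)$$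 and $$T(1,a)\circ\alpha_l(A\otimes A',X,Y)=T(a,1)\circ\alpha_l(A,A'\otimes X,A'\otimes Y)\circ\alpha_l(A',X,Y),$$ where $\ell_X: I\otimes X\to X$ and $a:(A\otimes A')\otimes X\to A\otimes(A'\otimes X)$, and likewise for $Y$. It is *strong* if for all $A,X,Y$ the composite $$\beta_l(A,X,Y)=\Big(T(X,Y^A)\xrightarrow{\ \alpha_l(A,X,Y^A)\ }T(A\otimes X,A\otimes Y^A)\xrightarrow{\ T(1,e_r)\ }T(A\otimes X,Y)\Big)$$ is invertible. The left Tambara modules are the objects of a $\mathcal V$-category $\mathrm{LTamb}(\mathcal A)$. Its hom-object from $(T,\alpha_l)$ to $(T',\alpha'_l)$ is the joint equalizer $\iota$, over all $A,X,Y$, of the two morphisms $$[\mathcal A^{\mathrm{op}}\otimes\mathcal A,\mathcal V](T,T')\rightrightarrows\mathcal V\big(T(X,Y),T'(A\otimes X,A\otimes Y)\big)$$ given by $\mathcal V(\alpha_l(A,X,Y),1)\circ\mathrm{pr}_{A\otimes X,A\otimes Y}$ and $\mathcal V(1,\alpha'_l(A,X,Y))\circ\mathrm{pr}_{X,Y}$.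 Its identities and composition are those of the functor $\mathcal V$-category $[\mathcal A^{\mathrm{op}}\otimes\mathcal A,\mathcal V]$. Let $\mathrm{LTamb}_s(\mathcal A)$ be its full sub-$\mathcal V$-category of strong left Tambara modules. The Cayley $\mathcal V$-functor $\Upsilon:[\mathcal A,\mathcal V]\to[\mathcal A^{\mathrm{op}}\otimes\mathcal A,\mathcal V]$ sends $F$ to $T_F$, where $T_F(X,Y)=F(Y^X)$, and is determined on homs by $\mathrm{pr}_{X,Y}\circ\Upsilon_{F,G}=\mathrm{pr}_{Y^X}$. With the structure morphisms $$\alpha_l(A,X,Y)=\Big(F(Y^X)\xrightarrow{\ F((d_r)^X)\ }F\big(((A\otimes Y)^A)^X\big)\cong F\big((A\otimes Y)^{A\otimes X}\big)\Big),$$ $T_F$ is a strong left Tambara module, and $\Upsilon$ lifts to a $\mathcal V$-functor $\hat\Upsilon:[\mathcal A,\mathcal V]\to\mathrm{LTamb}_s(\mathcal A)$, with $\iota\circ\hat\Upsilon=\Upsilon$ on homs. **Proposition.** The $\mathcal V$-functor $\hat\Upsilon:[\mathcal A,\mathcal V]\to\mathrm{LTamb}_s(\mathcal A)$ is an equivalence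 of $\mathcal V$-categories: there are a $\mathcal V$-functor $\Phi:\mathrm{LTamb}_s(\mathcal A)\to[\mathcal A,\mathcal V]$ and $\mathcal V$-natural isomorphisms $1\cong\Phi\circ\hat\Upsilon$ and $\hat\Upsilon\circ\Phi\cong 1$. -/

import Mathlib

open CategoryTheory MonoidalCategory BraidedCategory Opposite Limits

universe w v v₁ u u₁ u₂ u₃

namespace Tambara

section Graded

variable {V : Type u} [Category.{w} V] [MonoidalCategory V]
  {C : Type u₁} [EnrichedCategory V C]

/-- Composition of generalised elements `f` and `g` of hom-objects. -/
def gcomp {P Q : V} {x y z : C} (f : P ⟶ (x ⟶[V] y)) (g : Q ⟶ (y ⟶[V] z)) :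
    P ⊗ Q ⟶ (x ⟶[V] z) :=
  (f ⊗ₘ g) ≫ eComp V x y z

lemma tensorHom_gcomp {P Q P' Q' : V} {x y z : C} (a : P' ⟶ P) (b : Q' ⟶ Q)
    (f : P ⟶ (x ⟶[V] y)) (g : Q ⟶ (y ⟶[V] z)) :
    (a ⊗ₘ b) ≫ gcomp f g = gcomp (a ≫ f) (b ≫ g) := by
  simp [gcomp]

lemma whiskerRight_gcomp {P Q P' : V} {x y z : C} (a : P' ⟶ P)
    (f : P ⟶ (x ⟶[V] y)) (g : Q ⟶ (y ⟶[V] z)) :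
    (a ▷ Q) ≫ gcomp f g = gcomp (a ≫ f) g := by
  rw [← tensorHom_id, tensorHom_gcomp, Category.id_comp]

lemma whiskerLeft_gcomp {P Q Q' : V} {x y z : C} (b : Q' ⟶ Q)
    (f : P ⟶ (x ⟶[V] y)) (g : Q ⟶ (y ⟶[V] z)) :
    (P ◁ b) ≫ gcomp f g = gcomp f (b ≫ g) := by
  rw [← id_tensorHom, tensorHom_gcomp, Category.id_comp]

lemma gcomp_assoc {P Q R : V} {x y z t : C} (f : P ⟶ (x ⟶[V] y)) (g : Q ⟶ (y ⟶[V] z))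
    (h : R ⟶ (z ⟶[V] t)) :
    gcomp (gcomp f g) h = (α_ P Q R).hom ≫ gcomp f (gcomp g h) := by
  have e := e_assoc' V x y z t
  have h₁ : gcomp (gcomp f g) h = ((f ⊗ₘ g) ⊗ₘ h) ≫ eComp V x y z ▷ _ ≫ eComp V x z t := by
    simp only [gcomp]
    rw [← tensorHom_id, tensorHom_comp_tensorHom_assoc, Category.comp_id]
  have h₂ : gcomp f (gcomp g h) = (f ⊗ₘ (g ⊗ₘ h)) ≫ _ ◁ eComp V y z t ≫ eComp V x y t := by
    simp only [gcomp]
    rw [← id_tensorHom, tensorHom_comp_tensorHom_assoc, Category.comp_id]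
  rw [h₁, h₂, ← e, associator_naturality_assoc]

lemma gcomp_eId {P : V} {x y : C} (f : P ⟶ (x ⟶[V] y)) :
    gcomp f (eId V y) = (ρ_ P).hom ≫ f := by
  have e := e_comp_id V x y
  rw [Iso.inv_comp_eq, Category.comp_id] at e
  rw [gcomp, MonoidalCategory.tensorHom_def, Category.assoc, e, rightUnitor_naturality]

lemma eId_gcomp {P : V} {x y : C} (f : P ⟶ (x ⟶[V] y)) :
    gcomp (eId V x) f = (λ_ P).hom ≫ f := by
  have e := e_id_comp V x y
  rw [Iso.inv_comp_eq, Category.comp_id] at e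
  rw [gcomp, MonoidalCategory.tensorHom_def', Category.assoc, e, leftUnitor_naturality]

lemma gcomp_map {D : Type u₂} [EnrichedCategory V D] (F : EnrichedFunctor V C D)
    {P Q : V} {x y z : C} (f : P ⟶ (x ⟶[V] y)) (g : Q ⟶ (y ⟶[V] z)) :
    gcomp f g ≫ F.map x z = gcomp (f ≫ F.map x y) (g ≫ F.map y z) := by
  simp [gcomp]

end Graded

section TensorProduct

/-- Objects of the tensor product `C ⊗ D` of two `V`-categories: pairs of objects. -/
structure TensorCat (C : Type u₁) (D : Type u₂) where
  /-- the component in the first `V`-category -/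
  fst : C
  /-- the component in the second `V`-category -/
  snd : D

variable {V : Type u} [Category.{w} V] [MonoidalCategory V] [BraidedCategory V]
  {C : Type u₁} [EnrichedCategory V C] {D : Type u₂} [EnrichedCategory V D]
  {E : Type u₃} [EnrichedCategory V E]

/-- The tensor product `C ⊗ D` of `V`-categories: homs are tensor products of homs and composition
uses the middle-four interchange of `V`. -/
instance tensorCat : EnrichedCategory V (TensorCat C D) where
  Hom P Q := (P.fst ⟶[V] Q.fst) ⊗ (P.snd ⟶[V] Q.snd)
  id P := (λ_ (𝟙_ V)).inv ≫ (eId V P.fst ⊗ₘ eId V P.snd)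
  comp P Q R := tensorμ _ _ _ _ ≫ (eComp V P.fst Q.fst R.fst ⊗ₘ eComp V P.snd Q.snd R.snd)
  id_comp P Q := by
    have e₁ := e_id_comp V P.fst Q.fst
    have e₂ := e_id_comp V P.snd Q.snd
    rw [Iso.inv_comp_eq, Category.comp_id] at e₁ e₂
    rw [Iso.inv_comp_eq, Category.comp_id, comp_whiskerRight, Category.assoc,
      tensorμ_natural_left_assoc, tensorHom_comp_tensorHom, e₁, e₂, tensor_left_unitality]
  comp_id P Q := by
    have e₁ := e_comp_id V P.fst Q.fst
    have e₂ := e_comp_id V P.snd Q.snd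
    rw [Iso.inv_comp_eq, Category.comp_id] at e₁ e₂
    rw [Iso.inv_comp_eq, Category.comp_id, MonoidalCategory.whiskerLeft_comp, Category.assoc,
      tensorμ_natural_right_assoc, tensorHom_comp_tensorHom, e₁, e₂, tensor_right_unitality]
  assoc P Q R S := by
    rw [Iso.inv_comp_eq, comp_whiskerRight, Category.assoc, tensorμ_natural_left_assoc,
      tensorHom_comp_tensorHom, MonoidalCategory.whiskerLeft_comp, Category.assoc,
      tensorμ_natural_right_assoc, tensorHom_comp_tensorHom, ← e_assoc', ← e_assoc',
      ← tensorHom_comp_tensorHom, reassoc_of% tensor_associativity]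

lemma tensorCat_hom (P Q : TensorCat C D) :
    (P ⟶[V] Q) = ((P.fst ⟶[V] Q.fst) ⊗ (P.snd ⟶[V] Q.snd) : V) := rfl

/-- Composition in `C ⊗ D` of generalised elements that are tensor products. -/
lemma tensor_gcomp {P P' Q Q' : V} {x y z : TensorCat C D}
    (f : P ⟶ (x.fst ⟶[V] y.fst)) (f' : P' ⟶ (x.snd ⟶[V] y.snd))
    (g : Q ⟶ (y.fst ⟶[V] z.fst)) (g' : Q' ⟶ (y.snd ⟶[V] z.snd)) :
    gcomp (x := x) (y := y) (z := z) (f ⊗ₘ f') (g ⊗ₘ g') =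
      tensorμ P P' Q Q' ≫ (gcomp f g ⊗ₘ gcomp f' g') := by
  change ((f ⊗ₘ f') ⊗ₘ (g ⊗ₘ g')) ≫ tensorμ _ _ _ _ ≫ (eComp V _ _ _ ⊗ₘ eComp V _ _ _) = _
  rw [reassoc_of% tensorμ_natural, tensorHom_comp_tensorHom]
  rfl

lemma tensorμ_unit_right (X Y : V) :
    ((ρ_ X).inv ⊗ₘ (ρ_ Y).inv) ≫ tensorμ X (𝟙_ V) Y (𝟙_ V) ≫ (𝟙 (X ⊗ Y) ⊗ₘ (λ_ (𝟙_ V)).hom) =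
      (ρ_ (X ⊗ Y)).inv := by
  simp only [tensorμ, braiding_tensorUnit_left]
  monoidal

lemma tensorμ_unit_left (X Y : V) :
    ((λ_ X).inv ⊗ₘ (λ_ Y).inv) ≫ tensorμ (𝟙_ V) X (𝟙_ V) Y ≫ ((λ_ (𝟙_ V)).hom ⊗ₘ 𝟙 (X ⊗ Y)) =
      (λ_ (X ⊗ Y)).inv := by
  simp only [tensorμ, braiding_tensorUnit_right]
  monoidal

lemma tensorμ_unit_mid (X Y : V) :
    ((ρ_ X).inv ⊗ₘ (λ_ Y).inv) ≫ tensorμ X (𝟙_ V) (𝟙_ V) Y ≫ ((ρ_ X).hom ⊗ₘ (λ_ Y).hom) =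
      𝟙 (X ⊗ Y) := by
  simp only [tensorμ, braiding_tensorUnit_right]
  monoidal

lemma tensorμ_unit_outer (X Y : V) :
    ((λ_ Y).inv ⊗ₘ (ρ_ X).inv) ≫ tensorμ (𝟙_ V) Y X (𝟙_ V) ≫ ((λ_ X).hom ⊗ₘ (ρ_ Y).hom) =
      (β_ Y X).hom := by
  simp only [tensorμ]
  monoidal

/-- The map `C(c, c') ⟶ (C ⊗ D)((c, d), (c', d))` that tensors with the identity of `d`. -/
def inclLMap (c c' : C) (d : D) :
    (c ⟶[V] c') ⟶ ((⟨c, d⟩ : TensorCat C D) ⟶[V] ⟨c', d⟩) :=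
  (ρ_ _).inv ≫ (𝟙 (c ⟶[V] c') ⊗ₘ eId V d)

/-- The map `D(d, d') ⟶ (C ⊗ D)((c, d), (c, d'))` that tensors with the identity of `c`. -/
def inclRMap (c : C) (d d' : D) :
    (d ⟶[V] d') ⟶ ((⟨c, d⟩ : TensorCat C D) ⟶[V] ⟨c, d'⟩) :=
  (λ_ _).inv ≫ (eId V c ⊗ₘ 𝟙 (d ⟶[V] d'))

/-- The `V`-functor `(-, d) : C ⟶ C ⊗ D`. -/
def inclL (d : D) : EnrichedFunctor V C (TensorCat C D) where
  obj c := ⟨c, d⟩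
  map c c' := inclLMap c c' d
  map_id c := by
    rw [inclLMap, rightUnitor_inv_naturality_assoc, ← tensorHom_id, tensorHom_comp_tensorHom,
      Category.comp_id, Category.id_comp, ← unitors_inv_equal]
    rfl
  map_comp x y z := by
    change _ = gcomp (x := (⟨x, d⟩ : TensorCat C D)) (y := ⟨y, d⟩) (z := ⟨z, d⟩)
      ((ρ_ _).inv ≫ _) ((ρ_ _).inv ≫ _)
    rw [← tensorHom_gcomp, tensor_gcomp, eId_gcomp, inclLMap, rightUnitor_inv_naturality_assoc,
      ← tensorμ_unit_right, ← tensorHom_id, Category.assoc, Category.assoc,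
      tensorHom_comp_tensorHom, tensorHom_comp_tensorHom, Category.id_comp, Category.comp_id]
    simp [gcomp]

/-- The `V`-functor `(c, -) : D ⟶ C ⊗ D`. -/
def inclR (c : C) : EnrichedFunctor V D (TensorCat C D) where
  obj d := ⟨c, d⟩
  map d d' := inclRMap c d d'
  map_id d := by
    rw [inclRMap, leftUnitor_inv_naturality_assoc, ← id_tensorHom, tensorHom_comp_tensorHom,
      Category.comp_id, Category.id_comp]
    rfl
  map_comp x y z := by
    change _ = gcomp (x := (⟨c, x⟩ : TensorCat C D)) (y := ⟨c, y⟩) (z := ⟨c, z⟩)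
      ((λ_ _).inv ≫ _) ((λ_ _).inv ≫ _)
    rw [← tensorHom_gcomp, tensor_gcomp, gcomp_eId, inclRMap, leftUnitor_inv_naturality_assoc,
      ← tensorμ_unit_left, unitors_equal, ← id_tensorHom, Category.assoc, Category.assoc,
      tensorHom_comp_tensorHom, tensorHom_comp_tensorHom, Category.id_comp, Category.comp_id]
    simp [gcomp]

lemma inclLMap_gcomp_inclRMap (c c' : C) (d d' : D) :
    gcomp (inclLMap (V := V) c c' d) (inclRMap (V := V) c' d d') =
      𝟙 ((⟨c, d⟩ : TensorCat C D) ⟶[V] ⟨c', d'⟩) := by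
  rw [inclLMap, inclRMap, ← tensorHom_gcomp, tensor_gcomp, gcomp_eId, eId_gcomp,
    Category.comp_id, Category.comp_id]
  exact tensorμ_unit_mid _ _

lemma inclRMap_gcomp_inclLMap (c c' : C) (d d' : D) :
    gcomp (inclRMap (V := V) c d d') (inclLMap (V := V) c c' d') =
      (β_ (d ⟶[V] d') (c ⟶[V] c')).hom := by
  rw [inclLMap, inclRMap, ← tensorHom_gcomp, tensor_gcomp, gcomp_eId, eId_gcomp,
    Category.comp_id, Category.comp_id]
  exact tensorμ_unit_outer _ _

/-- Action of a `V`-functor `P : C ⊗ D ⟶ E` on homs in its first variable. -/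
def actL (P : EnrichedFunctor V (TensorCat C D) E) (c c' : C) (d : D) :
    (c ⟶[V] c') ⟶ (P.obj ⟨c, d⟩ ⟶[V] P.obj ⟨c', d⟩) :=
  inclLMap c c' d ≫ P.map ⟨c, d⟩ ⟨c', d⟩

/-- Action of a `V`-functor `P : C ⊗ D ⟶ E` on homs in its second variable. -/
def actR (P : EnrichedFunctor V (TensorCat C D) E) (c : C) (d d' : D) :
    (d ⟶[V] d') ⟶ (P.obj ⟨c, d⟩ ⟶[V] P.obj ⟨c, d'⟩) :=
  inclRMap c d d' ≫ P.map ⟨c, d⟩ ⟨c, d'⟩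

lemma actL_id (P : EnrichedFunctor V (TensorCat C D) E) (c : C) (d : D) :
    eId V c ≫ actL P c c d = eId V _ := ((inclL d).comp V P).map_id c

lemma actR_id (P : EnrichedFunctor V (TensorCat C D) E) (c : C) (d : D) :
    eId V d ≫ actR P c d d = eId V _ := ((inclR c).comp V P).map_id d

lemma actL_comp (P : EnrichedFunctor V (TensorCat C D) E) (x y z : C) (d : D) :
    eComp V x y z ≫ actL P x z d = gcomp (actL P x y d) (actL P y z d) :=
  ((inclL d).comp V P).map_comp x y z

lemma actR_comp (P : EnrichedFunctor V (TensorCat C D) E) (c : C) (x y z : D) :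
    eComp V x y z ≫ actR P c x z = gcomp (actR P c x y) (actR P c y z) :=
  ((inclR c).comp V P).map_comp x y z

lemma actL_gcomp_actR (P : EnrichedFunctor V (TensorCat C D) E) (c c' : C) (d d' : D) :
    gcomp (actL P c c' d) (actR P c' d d') = P.map ⟨c, d⟩ ⟨c', d'⟩ := by
  rw [actL, actR, ← gcomp_map, inclLMap_gcomp_inclRMap]
  exact Category.id_comp _

lemma actR_gcomp_actL (P : EnrichedFunctor V (TensorCat C D) E) (c c' : C) (d d' : D) :
    gcomp (actR P c d d') (actL P c c' d') =
      (β_ (d ⟶[V] d') (c ⟶[V] c')).hom ≫ gcomp (actL P c c' d) (actR P c' d d') := by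
  rw [actL_gcomp_actR, actL, actR, ← gcomp_map, inclRMap_gcomp_inclLMap]

/-- A `V`-functor `C ⊗ D ⟶ E` from its two partial `V`-functors, if these commute. -/
def mkBifunctor (obj : C → D → E)
    (l : ∀ (c c' : C) (d : D), (c ⟶[V] c') ⟶ (obj c d ⟶[V] obj c' d))
    (r : ∀ (c : C) (d d' : D), (d ⟶[V] d') ⟶ (obj c d ⟶[V] obj c d'))
    (l_id : ∀ c d, eId V c ≫ l c c d = eId V _)
    (r_id : ∀ c d, eId V d ≫ r c d d = eId V _)
    (l_comp : ∀ x y z d, eComp V x y z ≫ l x z d = gcomp (l x y d) (l y z d))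
    (r_comp : ∀ c x y z, eComp V x y z ≫ r c x z = gcomp (r c x y) (r c y z))
    (comm : ∀ c c' d d', gcomp (r c d d') (l c c' d') =
      (β_ (d ⟶[V] d') (c ⟶[V] c')).hom ≫ gcomp (l c c' d) (r c' d d')) :
    EnrichedFunctor V (TensorCat C D) E where
  obj P := obj P.fst P.snd
  map P Q := gcomp (l P.fst Q.fst P.snd) (r Q.fst P.snd Q.snd)
  map_id P := by
    change ((λ_ (𝟙_ V)).inv ≫ (eId V P.fst ⊗ₘ eId V P.snd)) ≫ _ = _
    rw [Category.assoc, tensorHom_gcomp, l_id, r_id, eId_gcomp, Iso.inv_hom_id_assoc]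
  map_comp P Q R := by
    change (tensorμ _ _ _ _ ≫ (eComp V _ _ _ ⊗ₘ eComp V _ _ _)) ≫ _ = gcomp (gcomp _ _) (gcomp _ _)
    rw [Category.assoc, tensorHom_gcomp, l_comp, r_comp, gcomp_assoc, gcomp_assoc, tensorμ]
    simp only [Category.assoc, Iso.inv_hom_id_assoc]
    have h₁ := gcomp_assoc (r Q.fst P.snd Q.snd) (l Q.fst R.fst Q.snd) (r R.fst Q.snd R.snd)
    have h₂ := gcomp_assoc (l Q.fst R.fst P.snd) (r R.fst P.snd Q.snd) (r R.fst Q.snd R.snd)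
    rw [← Iso.inv_comp_eq] at h₁
    rw [← h₁, comm, ← whiskerRight_gcomp, h₂]
    simp [← whiskerLeft_gcomp]

lemma actL_mkBifunctor (obj : C → D → E)
    (l : ∀ (c c' : C) (d : D), (c ⟶[V] c') ⟶ (obj c d ⟶[V] obj c' d))
    (r : ∀ (c : C) (d d' : D), (d ⟶[V] d') ⟶ (obj c d ⟶[V] obj c d'))
    (l_id r_id l_comp r_comp comm) (c c' : C) (d : D) :
    actL (mkBifunctor obj l r l_id r_id l_comp r_comp comm) c c' d = l c c' d := by
  change inclLMap c c' d ≫ gcomp (l c c' d) (r c' d d) = _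
  rw [inclLMap, Category.assoc, tensorHom_gcomp, r_id, gcomp_eId, Category.id_comp, Iso.inv_hom_id_assoc]

lemma actR_mkBifunctor (obj : C → D → E)
    (l : ∀ (c c' : C) (d : D), (c ⟶[V] c') ⟶ (obj c d ⟶[V] obj c' d))
    (r : ∀ (c : C) (d d' : D), (d ⟶[V] d') ⟶ (obj c d ⟶[V] obj c d'))
    (l_id r_id l_comp r_comp comm) (c : C) (d d' : D) :
    actR (mkBifunctor obj l r l_id r_id l_comp r_comp comm) c d d' = r c d d' := by
  change inclRMap c d d' ≫ gcomp (l c c d) (r c d d') = _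
  rw [inclRMap, Category.assoc, tensorHom_gcomp, l_id, eId_gcomp, Category.id_comp, Iso.inv_hom_id_assoc]

end TensorProduct

section FunctorCategory

variable {V : Type u} [Category.{w} V] [MonoidalCategory V] [SymmetricCategory V]
  {C : Type u₁} [EnrichedCategory V C] {D : Type u₂} [EnrichedCategory V D]

/-- `V`-naturality of a family `φ c : P ⟶ D(F c, G c)` parametrised by an object `P` of `V`: the
two composites `C(c, d) ⊗ P ⟶ D(F c, G d)` agree. -/
def IsVNatural {F G : EnrichedFunctor V C D} {P : V}
    (φ : ∀ c, P ⟶ (F.obj c ⟶[V] G.obj c)) : Prop :=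
  ∀ c d : C, gcomp (F.map c d) (φ d) = (β_ (c ⟶[V] d) P).hom ≫ gcomp (φ c) (G.map c d)

lemma IsVNatural.precomp {F G : EnrichedFunctor V C D} {P Q : V}
    {φ : ∀ c, P ⟶ (F.obj c ⟶[V] G.obj c)} (h : IsVNatural φ) (a : Q ⟶ P) :
    IsVNatural (fun c => a ≫ φ c) := fun c d => by
  rw [← whiskerLeft_gcomp, h, ← whiskerRight_gcomp, braiding_naturality_right_assoc]

lemma isVNatural_eId (F : EnrichedFunctor V C D) :
    IsVNatural (F := F) (G := F) (fun c => eId V (F.obj c)) := fun c d => by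
  rw [gcomp_eId, eId_gcomp]
  simp

lemma IsVNatural.gcomp {F G H : EnrichedFunctor V C D} {P Q : V}
    {φ : ∀ c, P ⟶ (F.obj c ⟶[V] G.obj c)} {ψ : ∀ c, Q ⟶ (G.obj c ⟶[V] H.obj c)}
    (h : IsVNatural φ) (k : IsVNatural ψ) :
    IsVNatural (fun c => gcomp (φ c) (ψ c)) := fun c d => by
  have e₁ := gcomp_assoc (F.map c d) (φ d) (ψ d)
  rw [← Iso.inv_comp_eq] at e₁
  rw [← e₁, h, ← whiskerRight_gcomp, gcomp_assoc, k, ← whiskerLeft_gcomp, gcomp_assoc,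
    braiding_tensor_right_hom]
  simp

/-- A `V`-natural isomorphism between `V`-functors: a `V`-natural family of elements
`I ⟶ D(F c, G c)` with a `V`-natural inverse family. -/
structure VNatIso (F G : EnrichedFunctor V C D) where
  /-- the components -/
  hom : ∀ c, 𝟙_ V ⟶ (F.obj c ⟶[V] G.obj c)
  /-- the components of the inverse -/
  inv : ∀ c, 𝟙_ V ⟶ (G.obj c ⟶[V] F.obj c)
  hom_natural : IsVNatural hom
  inv_natural : IsVNatural inv
  hom_inv : ∀ c, (λ_ (𝟙_ V)).inv ≫ gcomp (hom c) (inv c) = eId V (F.obj c)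
  inv_hom : ∀ c, (λ_ (𝟙_ V)).inv ≫ gcomp (inv c) (hom c) = eId V (G.obj c)

/-- A `V`-functor is an equivalence of `V`-categories if it has an inverse up to `V`-natural
isomorphism. -/
def IsVEquivalence (F : EnrichedFunctor V C D) : Prop :=
  ∃ G : EnrichedFunctor V D C,
    Nonempty (VNatIso (EnrichedFunctor.id V C) (F.comp V G)) ∧
    Nonempty (VNatIso (G.comp V F) (EnrichedFunctor.id V D))

end FunctorCategory

section FunctorCategoryHom

variable {V : Type u} [Category.{w} V] [MonoidalCategory V] [SymmetricCategory V]
  [MonoidalClosed V] [HasLimits V]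
  {C : Type w} [EnrichedCategory V C] {D : Type u₂} [EnrichedCategory V D]

/-- One of the two maps whose equalizer is the end `∫_c D(F c, G c)`. -/
noncomputable def endL (F G : EnrichedFunctor V C D) :
    (∏ᶜ fun c : C => (F.obj c ⟶[V] G.obj c)) ⟶
      ∏ᶜ fun p : C × C => (ihom (p.1 ⟶[V] p.2)).obj (F.obj p.1 ⟶[V] G.obj p.2) :=
  Pi.lift fun p => MonoidalClosed.curry (gcomp (F.map p.1 p.2) (Pi.π _ p.2))

/-- The other of the two maps whose equalizer is the end `∫_c D(F c, G c)`. -/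
noncomputable def endR (F G : EnrichedFunctor V C D) :
    (∏ᶜ fun c : C => (F.obj c ⟶[V] G.obj c)) ⟶
      ∏ᶜ fun p : C × C => (ihom (p.1 ⟶[V] p.2)).obj (F.obj p.1 ⟶[V] G.obj p.2) :=
  Pi.lift fun p => MonoidalClosed.curry
    ((β_ (p.1 ⟶[V] p.2) _).hom ≫ gcomp (Pi.π _ p.1) (G.map p.1 p.2))

/-- The hom-object `[C, D](F, G) = ∫_c D(F c, G c)`. -/
noncomputable abbrev natObj (F G : EnrichedFunctor V C D) : V := equalizer (endL F G) (endR F G)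

/-- The projection from the end to its `c`-component. -/
noncomputable def endPr (F G : EnrichedFunctor V C D) (c : C) :
    natObj F G ⟶ (F.obj c ⟶[V] G.obj c) :=
  equalizer.ι (endL F G) (endR F G) ≫ Pi.π _ c

lemma natObj_ext {F G : EnrichedFunctor V C D} {P : V} {a b : P ⟶ natObj F G}
    (h : ∀ c, a ≫ endPr F G c = b ≫ endPr F G c) : a = b := by
  refine equalizer.hom_ext (Pi.hom_ext _ _ fun c => ?_)
  have := h c
  simp only [endPr, ← Category.assoc] at this
  exact this

lemma isVNatural_iff {F G : EnrichedFunctor V C D} {P : V}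
    (φ : P ⟶ ∏ᶜ fun c : C => (F.obj c ⟶[V] G.obj c)) :
    φ ≫ endL F G = φ ≫ endR F G ↔ IsVNatural (fun c => φ ≫ Pi.π _ c) := by
  have key (p : C × C) :
      (φ ≫ endL F G) ≫ Pi.π _ p =
          MonoidalClosed.curry (gcomp (F.map p.1 p.2) (φ ≫ Pi.π _ p.2)) ∧
        (φ ≫ endR F G) ≫ Pi.π _ p =
          MonoidalClosed.curry ((β_ (p.1 ⟶[V] p.2) _).hom ≫
            gcomp (φ ≫ Pi.π _ p.1) (G.map p.1 p.2)) := by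
    constructor
    · rw [← whiskerLeft_gcomp, MonoidalClosed.curry_natural_left]
      simp [endL]
    · rw [← whiskerRight_gcomp, ← braiding_naturality_right_assoc,
        MonoidalClosed.curry_natural_left]
      simp [endR]
  constructor
  · intro h c d
    have := congrArg (· ≫ Pi.π _ (c, d)) h
    simp only [(key (c, d)).1, (key (c, d)).2] at this
    exact MonoidalClosed.curry_injective this
  · intro h
    refine Pi.hom_ext _ _ fun p => ?_
    rw [(key p).1, (key p).2, h p.1 p.2]

lemma isVNatural_endPr (F G : EnrichedFunctor V C D) : IsVNatural (endPr F G) :=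
  (isVNatural_iff _).1 (equalizer.condition (endL F G) (endR F G))

/-- The universal property of the end. -/
noncomputable def endLift {F G : EnrichedFunctor V C D} {P : V}
    (φ : ∀ c, P ⟶ (F.obj c ⟶[V] G.obj c)) (h : IsVNatural φ) : P ⟶ natObj F G :=
  equalizer.lift (Pi.lift φ) ((isVNatural_iff _).2 (by simpa using h))

lemma endLift_endPr {F G : EnrichedFunctor V C D} {P : V}
    (φ : ∀ c, P ⟶ (F.obj c ⟶[V] G.obj c)) (h : IsVNatural φ) (c : C) :
    endLift φ h ≫ endPr F G c = φ c := by
  rw [endPr, endLift, equalizer.lift_ι_assoc, Pi.lift_π]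

/-- The functor `V`-category `[C, D]`, with homs the ends `∫_c D(F c, G c)`. -/
noncomputable instance functorVCat : EnrichedCategory V (EnrichedFunctor V C D) where
  Hom F G := natObj F G
  id F := endLift (fun c => eId V (F.obj c)) (isVNatural_eId F)
  comp F G H := endLift (fun c => gcomp (endPr F G c) (endPr G H c))
    ((isVNatural_endPr F G).gcomp (isVNatural_endPr G H))
  id_comp F G := natObj_ext fun c => by
    rw [Category.assoc, Category.assoc, endLift_endPr, whiskerRight_gcomp, endLift_endPr, eId_gcomp,
      Iso.inv_hom_id_assoc, Category.id_comp]
  comp_id F G := natObj_ext fun c => by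
    rw [Category.assoc, Category.assoc, endLift_endPr, whiskerLeft_gcomp, endLift_endPr, gcomp_eId,
      Iso.inv_hom_id_assoc, Category.id_comp]
  assoc F G H K := natObj_ext fun c => by
    rw [Category.assoc, Category.assoc, Category.assoc, endLift_endPr, endLift_endPr,
      whiskerRight_gcomp, whiskerLeft_gcomp, endLift_endPr, endLift_endPr, gcomp_assoc,
      Iso.inv_hom_id_assoc]

/-- The projection `pr_c : [C, D](F, G) ⟶ D(F c, G c)`. -/
noncomputable def pr (F G : EnrichedFunctor V C D) (c : C) :
    (F ⟶[V] G) ⟶ (F.obj c ⟶[V] G.obj c) := endPr F G c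

lemma isVNatural_pr (F G : EnrichedFunctor V C D) : IsVNatural (pr F G) := isVNatural_endPr F G

lemma natHom_ext {F G : EnrichedFunctor V C D} {P : V} {a b : P ⟶ (F ⟶[V] G)}
    (h : ∀ c, a ≫ pr F G c = b ≫ pr F G c) : a = b := natObj_ext h

/-- The universal property of the hom-object `[C, D](F, G)`. -/
noncomputable def natLift {F G : EnrichedFunctor V C D} {P : V}
    (φ : ∀ c, P ⟶ (F.obj c ⟶[V] G.obj c)) (h : IsVNatural φ) : P ⟶ (F ⟶[V] G) := endLift φ h

lemma natLift_pr {F G : EnrichedFunctor V C D} {P : V}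
    (φ : ∀ c, P ⟶ (F.obj c ⟶[V] G.obj c)) (h : IsVNatural φ) (c : C) :
    natLift φ h ≫ pr F G c = φ c := endLift_endPr φ h c

lemma eId_pr (F : EnrichedFunctor V C D) (c : C) :
    eId V F ≫ pr F F c = eId V (F.obj c) :=
  endLift_endPr _ (isVNatural_eId F) c

lemma eComp_pr (F G H : EnrichedFunctor V C D) (c : C) :
    eComp V F G H ≫ pr F H c = gcomp (pr F G c) (pr G H c) :=
  endLift_endPr _ ((isVNatural_endPr F G).gcomp (isVNatural_endPr G H)) c

section Precompose

variable {B : Type w} [EnrichedCategory V B]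

lemma isVNatural_precompose (K : EnrichedFunctor V B C) (F G : EnrichedFunctor V C D) :
    IsVNatural (F := K.comp V F) (G := K.comp V G) (fun b => pr F G (K.obj b)) := fun b b' => by
  have := congrArg (fun t => (K.map b b' ▷ _) ≫ t) (isVNatural_pr F G (K.obj b) (K.obj b'))
  simp only [whiskerRight_gcomp, braiding_naturality_left_assoc, whiskerLeft_gcomp] at this
  exact this

/-- The effect on homs of precomposition with `K`: the `b`-component of the image is the
`K b`-component. -/
noncomputable def precomposeMap (K : EnrichedFunctor V B C) (F G : EnrichedFunctor V C D) :
    (F ⟶[V] G) ⟶ (K.comp V F ⟶[V] K.comp V G) :=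
  natLift (fun b => pr F G (K.obj b)) (isVNatural_precompose K F G)

lemma precomposeMap_pr (K : EnrichedFunctor V B C) (F G : EnrichedFunctor V C D) (b : B) :
    precomposeMap K F G ≫ pr (K.comp V F) (K.comp V G) b = pr F G (K.obj b) :=
  natLift_pr _ (isVNatural_precompose K F G) b

/-- The `V`-functor `[C, D] ⟶ [B, D]` given by precomposition with `K : B ⟶ C`. -/
noncomputable def precompose (K : EnrichedFunctor V B C) :
    EnrichedFunctor V (EnrichedFunctor V C D) (EnrichedFunctor V B D) where
  obj F := K.comp V F
  map F G := precomposeMap K F G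
  map_id F := natHom_ext fun b => by
    rw [Category.assoc, precomposeMap_pr]
    exact (eId_pr F (K.obj b)).trans (eId_pr (K.comp V F) b).symm
  map_comp F G H := natHom_ext fun b => by
    rw [Category.assoc, Category.assoc, precomposeMap_pr, eComp_pr, tensorHom_gcomp,
      precomposeMap_pr, precomposeMap_pr]
    exact eComp_pr F G H (K.obj b)

end Precompose

end FunctorCategoryHom

section Whisker

variable {V : Type u} [Category.{w} V] [MonoidalCategory V]
  {C : Type u₁} [Category.{v₁} C] [EnrichedOrdinaryCategory V C]
  {D : Type u₂} [Category.{v} D] [EnrichedOrdinaryCategory V D]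

lemma post_eq (x : C) {y z : C} (g : y ⟶ z) :
    eHomWhiskerLeft V x g = (ρ_ _).inv ≫ gcomp (𝟙 (x ⟶[V] y)) (eHomEquiv V g) := by
  rw [eHomWhiskerLeft, gcomp, id_tensorHom]

lemma pre_eq {x y : C} (f : x ⟶ y) (z : C) :
    eHomWhiskerRight V f z = (λ_ _).inv ≫ gcomp (eHomEquiv V f) (𝟙 (y ⟶[V] z)) := by
  rw [eHomWhiskerRight, gcomp, tensorHom_id]

lemma comp_post {P : V} {x y z : C} (f : P ⟶ (x ⟶[V] y)) (g : y ⟶ z) :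
    f ≫ eHomWhiskerLeft V x g = (ρ_ P).inv ≫ gcomp f (eHomEquiv V g) := by
  rw [post_eq, rightUnitor_inv_naturality_assoc, whiskerRight_gcomp, Category.comp_id]

lemma comp_pre {P : V} {x y z : C} (f : x ⟶ y) (g : P ⟶ (y ⟶[V] z)) :
    g ≫ eHomWhiskerRight V f z = (λ_ P).inv ≫ gcomp (eHomEquiv V f) g := by
  rw [pre_eq, leftUnitor_inv_naturality_assoc, whiskerLeft_gcomp, Category.comp_id]

lemma gcomp_post {P Q : V} {x y z t : C} (f : P ⟶ (x ⟶[V] y)) (g : Q ⟶ (y ⟶[V] z)) (h : z ⟶ t) :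
    gcomp f g ≫ eHomWhiskerLeft V x h = gcomp f (g ≫ eHomWhiskerLeft V y h) := by
  rw [gcomp, Category.assoc, eComp_eHomWhiskerLeft, ← id_tensorHom,
    tensorHom_comp_tensorHom_assoc, Category.comp_id, gcomp]

lemma gcomp_pre {P Q : V} {x y z t : C} (h : t ⟶ x) (f : P ⟶ (x ⟶[V] y)) (g : Q ⟶ (y ⟶[V] z)) :
    gcomp f g ≫ eHomWhiskerRight V h z = gcomp (f ≫ eHomWhiskerRight V h y) g := by
  rw [gcomp, Category.assoc, eComp_eHomWhiskerRight, ← tensorHom_id,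
    tensorHom_comp_tensorHom_assoc, Category.comp_id, gcomp]

lemma gcomp_mid {P Q : V} {x y y' z : C} (f : P ⟶ (x ⟶[V] y)) (h : y ⟶ y')
    (g : Q ⟶ (y' ⟶[V] z)) :
    gcomp f (g ≫ eHomWhiskerRight V h z) = gcomp (f ≫ eHomWhiskerLeft V x h) g := by
  rw [comp_pre, comp_post, ← whiskerRight_gcomp, ← whiskerLeft_gcomp, gcomp_assoc]
  simp

lemma hom_post {x y z : C} (f : x ⟶ y) (g : y ⟶ z) :
    eHomEquiv V f ≫ eHomWhiskerLeft V x g = eHomEquiv V (f ≫ g) := by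
  rw [comp_post, eHomEquiv_comp, unitors_inv_equal]
  rfl

lemma hom_pre {x y z : C} (f : x ⟶ y) (g : y ⟶ z) :
    eHomEquiv V g ≫ eHomWhiskerRight V f z = eHomEquiv V (f ≫ g) := by
  rw [comp_pre, eHomEquiv_comp]
  rfl

lemma eComp_eq_gcomp (x y z : C) :
    eComp V x y z = gcomp (𝟙 (x ⟶[V] y)) (𝟙 (y ⟶[V] z)) := by
  simp [gcomp]

end Whisker

section Monoidal

/-- A monoidal `V`-category: a `V`-category `A`, with underlying ordinary category also denoted `A`,
whose underlying category is monoidal in such a way that the tensor product extends to a `V`-functor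
`A ⊗ A ⟶ A` for which the associativity and unit constraints are `V`-natural. -/
class MonoidalVCategory (V : Type u) [Category.{w} V] [MonoidalCategory V] [BraidedCategory V]
    (A : Type u₁) [Category.{v₁} A] [EnrichedOrdinaryCategory V A] [MonoidalCategory A] where
  /-- the effect of the tensor product on homs -/
  tensorMap (X X' Y Y' : A) : (X ⟶[V] X') ⊗ (Y ⟶[V] Y') ⟶ ((X ⊗ Y) ⟶[V] (X' ⊗ Y'))
  /-- the `V`-functor extends the tensor product of the underlying category -/
  tensorMap_hom {X X' Y Y' : A} (f : X ⟶ X') (g : Y ⟶ Y') :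
    (λ_ (𝟙_ V)).inv ≫ (eHomEquiv V f ⊗ₘ eHomEquiv V g) ≫ tensorMap X X' Y Y' =
      eHomEquiv V (f ⊗ₘ g)
  tensorMap_comp (X X' X'' Y Y' Y'' : A) :
    tensorμ (X ⟶[V] X') (Y ⟶[V] Y') (X' ⟶[V] X'') (Y' ⟶[V] Y'') ≫
        (eComp V X X' X'' ⊗ₘ eComp V Y Y' Y'') ≫ tensorMap X X'' Y Y'' =
      (tensorMap X X' Y Y' ⊗ₘ tensorMap X' X'' Y' Y'') ≫ eComp V _ _ _
  associator_natural (X X' Y Y' Z Z' : A) :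
    tensorMap X X' Y Y' ▷ (Z ⟶[V] Z') ≫ tensorMap (X ⊗ Y) (X' ⊗ Y') Z Z' ≫
        eHomWhiskerLeft V _ (α_ X' Y' Z').hom =
      (α_ (X ⟶[V] X') (Y ⟶[V] Y') (Z ⟶[V] Z')).hom ≫ (X ⟶[V] X') ◁ tensorMap Y Y' Z Z' ≫
        tensorMap X X' (Y ⊗ Z) (Y' ⊗ Z') ≫ eHomWhiskerRight V (α_ X Y Z).hom _
  leftUnitor_natural (X X' : A) :
    (λ_ (X ⟶[V] X')).inv ≫ eId V (𝟙_ A) ▷ (X ⟶[V] X') ≫ tensorMap (𝟙_ A) (𝟙_ A) X X' ≫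
        eHomWhiskerLeft V _ (λ_ X').hom =
      eHomWhiskerRight V (λ_ X).hom _
  rightUnitor_natural (X X' : A) :
    (ρ_ (X ⟶[V] X')).inv ≫ (X ⟶[V] X') ◁ eId V (𝟙_ A) ≫ tensorMap X X' (𝟙_ A) (𝟙_ A) ≫
        eHomWhiskerLeft V _ (ρ_ X').hom =
      eHomWhiskerRight V (ρ_ X).hom _

variable (V : Type u) [Category.{w} V] [MonoidalCategory V] [BraidedCategory V]
  {A : Type u₁} [Category.{v₁} A] [EnrichedOrdinaryCategory V A] [MonoidalCategory A]
  [MonoidalVCategory V A]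

/-- The tensor product of a monoidal `V`-category as a `V`-functor `A ⊗ A ⟶ A`. -/
def tensorVFunctor (A : Type u₁) [Category.{v₁} A] [EnrichedOrdinaryCategory V A]
    [MonoidalCategory A] [MonoidalVCategory V A] : EnrichedFunctor V (TensorCat A A) A where
  obj P := P.fst ⊗ P.snd
  map P Q := MonoidalVCategory.tensorMap P.fst Q.fst P.snd Q.snd
  map_id P := by
    have := MonoidalVCategory.tensorMap_hom (V := V) (𝟙 P.fst) (𝟙 P.snd)
    rw [id_tensorHom_id, eHomEquiv_id, eHomEquiv_id, eHomEquiv_id] at this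
    rw [← this, ← Category.assoc]
    rfl
  map_comp P Q R := by
    rw [← MonoidalVCategory.tensorMap_comp, ← Category.assoc]
    rfl

/-- The map `A(Y, Y') ⟶ A(X ⊗ Y, X ⊗ Y')` given by the `V`-functor `X ⊗ -`. -/
def wl (X Y Y' : A) : (Y ⟶[V] Y') ⟶ ((X ⊗ Y) ⟶[V] (X ⊗ Y')) := actR (tensorVFunctor V A) X Y Y'

/-- The map `A(X, X') ⟶ A(X ⊗ Y, X' ⊗ Y)` given by the `V`-functor `- ⊗ Y`. -/
def wr (X X' Y : A) : (X ⟶[V] X') ⟶ ((X ⊗ Y) ⟶[V] (X' ⊗ Y)) := actL (tensorVFunctor V A) X X' Y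

lemma wl_id (X Y : A) : eId V Y ≫ wl V X Y Y = eId V (X ⊗ Y) := actR_id (tensorVFunctor V A) X Y

lemma wr_id (X Y : A) : eId V X ≫ wr V X X Y = eId V (X ⊗ Y) := actL_id (tensorVFunctor V A) X Y

lemma wl_comp (X Y Y' Y'' : A) :
    eComp V Y Y' Y'' ≫ wl V X Y Y'' = gcomp (wl V X Y Y') (wl V X Y' Y'') :=
  actR_comp (tensorVFunctor V A) X Y Y' Y''

lemma wr_comp (X X' X'' Y : A) :
    eComp V X X' X'' ≫ wr V X X'' Y = gcomp (wr V X X' Y) (wr V X' X'' Y) :=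
  actL_comp (tensorVFunctor V A) X X' X'' Y

lemma wl_gcomp_wr (X X' Y Y' : A) :
    gcomp (wl V X Y Y') (wr V X X' Y') =
      (β_ (Y ⟶[V] Y') (X ⟶[V] X')).hom ≫ gcomp (wr V X X' Y) (wl V X' Y Y') :=
  actR_gcomp_actL (tensorVFunctor V A) X X' Y Y'

lemma eHomEquiv_wl (X : A) {Y Y' : A} (g : Y ⟶ Y') :
    eHomEquiv V g ≫ wl V X Y Y' = eHomEquiv V (X ◁ g) := by
  have := MonoidalVCategory.tensorMap_hom (V := V) (𝟙 X) g
  rw [id_tensorHom, eHomEquiv_id] at this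
  rw [← this]
  change _ ≫ inclRMap X Y Y' ≫ MonoidalVCategory.tensorMap X X Y Y' = _
  rw [inclRMap, Category.assoc, leftUnitor_inv_naturality_assoc, ← id_tensorHom,
    tensorHom_comp_tensorHom_assoc, Category.id_comp, Category.comp_id]

lemma eHomEquiv_wr {X X' : A} (f : X ⟶ X') (Y : A) :
    eHomEquiv V f ≫ wr V X X' Y = eHomEquiv V (f ▷ Y) := by
  have := MonoidalVCategory.tensorMap_hom (V := V) f (𝟙 Y)
  rw [tensorHom_id, eHomEquiv_id] at this
  rw [← this]
  change _ ≫ inclLMap X X' Y ≫ MonoidalVCategory.tensorMap X X' Y Y = _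
  rw [inclLMap, Category.assoc, rightUnitor_inv_naturality_assoc, ← tensorHom_id,
    tensorHom_comp_tensorHom_assoc, Category.id_comp, Category.comp_id, unitors_inv_equal]

lemma wl_post (X : A) {Y Z Z' : A} (g : Z ⟶ Z') :
    wl V X Y Z ≫ eHomWhiskerLeft V _ (X ◁ g) = eHomWhiskerLeft V Y g ≫ wl V X Y Z' := by
  rw [comp_post, eHomWhiskerLeft, Category.assoc, Category.assoc, wl_comp, whiskerLeft_gcomp,
    eHomEquiv_wl]

lemma wl_pre (X : A) {Y Y' Z : A} (f : Y ⟶ Y') :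
    wl V X Y' Z ≫ eHomWhiskerRight V (X ◁ f) _ = eHomWhiskerRight V f Z ≫ wl V X Y Z := by
  rw [comp_pre, eHomWhiskerRight, Category.assoc, Category.assoc, wl_comp, whiskerRight_gcomp,
    eHomEquiv_wl]

lemma wr_post (X : A) {Y Z Z' : A} (g : Z ⟶ Z') :
    wr V Y Z X ≫ eHomWhiskerLeft V _ (g ▷ X) = eHomWhiskerLeft V Y g ≫ wr V Y Z' X := by
  rw [comp_post, eHomWhiskerLeft, Category.assoc, Category.assoc, wr_comp, whiskerLeft_gcomp,
    eHomEquiv_wr]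

lemma wr_pre (X : A) {Y Y' Z : A} (f : Y ⟶ Y') :
    wr V Y' Z X ≫ eHomWhiskerRight V (f ▷ X) _ = eHomWhiskerRight V f Z ≫ wr V Y Z X := by
  rw [comp_pre, eHomWhiskerRight, Category.assoc, Category.assoc, wr_comp, whiskerRight_gcomp,
    eHomEquiv_wr]

lemma wr_exchange (X X' : A) {Y Y' : A} (g : Y ⟶ Y') :
    wr V X X' Y' ≫ eHomWhiskerRight V (X ◁ g) _ = wr V X X' Y ≫ eHomWhiskerLeft V _ (X' ◁ g) := by
  rw [comp_pre, comp_post, ← eHomEquiv_wl, ← eHomEquiv_wl, ← whiskerRight_gcomp, wl_gcomp_wr,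
    ← whiskerLeft_gcomp, braiding_naturality_left_assoc, braiding_tensorUnit_left,
    Category.assoc, Iso.inv_hom_id_assoc]

lemma wl_exchange {X X' : A} (f : X ⟶ X') (Y Y' : A) :
    wl V X Y Y' ≫ eHomWhiskerLeft V _ (f ▷ Y') = wl V X' Y Y' ≫ eHomWhiskerRight V (f ▷ Y) _ := by
  rw [comp_pre, comp_post, ← eHomEquiv_wr, ← eHomEquiv_wr, ← whiskerLeft_gcomp, wl_gcomp_wr,
    ← whiskerRight_gcomp, braiding_naturality_right_assoc, braiding_tensorUnit_right,
    Category.assoc, Iso.inv_hom_id_assoc]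

lemma gcomp_wl {P Q : V} (X : A) {x y z : A} (f : P ⟶ (x ⟶[V] y)) (g : Q ⟶ (y ⟶[V] z)) :
    gcomp f g ≫ wl V X x z = gcomp (f ≫ wl V X x y) (g ≫ wl V X y z) := by
  rw [gcomp, Category.assoc, wl_comp, tensorHom_gcomp]

lemma gcomp_wr {P Q : V} (X : A) {x y z : A} (f : P ⟶ (x ⟶[V] y)) (g : Q ⟶ (y ⟶[V] z)) :
    gcomp f g ≫ wr V x z X = gcomp (f ≫ wr V x y X) (g ≫ wr V y z X) := by
  rw [gcomp, Category.assoc, wr_comp, tensorHom_gcomp]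

lemma gcomp_wl_wr {P Q : V} {X X' Y Y' : A} (f : P ⟶ (Y ⟶[V] Y')) (g : Q ⟶ (X ⟶[V] X')) :
    gcomp (f ≫ wl V X Y Y') (g ≫ wr V X X' Y') =
      (β_ P Q).hom ≫ gcomp (g ≫ wr V X X' Y) (f ≫ wl V X' Y Y') := by
  rw [← tensorHom_gcomp, wl_gcomp_wr, ← tensorHom_gcomp, braiding_naturality_assoc]

lemma tensorMap_eq (X X' Y Y' : A) :
    MonoidalVCategory.tensorMap X X' Y Y' = gcomp (wr V X X' Y) (wl V X' Y Y') :=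
  (actL_gcomp_actR (tensorVFunctor V A) X X' Y Y').symm

lemma eId_tensorMap (X Y Y' : A) {P : V} (g : P ⟶ (Y ⟶[V] Y')) :
    (eId V X ⊗ₘ g) ≫ MonoidalVCategory.tensorMap X X Y Y' = (λ_ P).hom ≫ g ≫ wl V X Y Y' := by
  rw [tensorMap_eq, tensorHom_gcomp, wr_id, eId_gcomp]

lemma tensorMap_eId (X X' Y : A) {P : V} (f : P ⟶ (X ⟶[V] X')) :
    (f ⊗ₘ eId V Y) ≫ MonoidalVCategory.tensorMap X X' Y Y = (ρ_ P).hom ≫ f ≫ wr V X X' Y := by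
  rw [tensorMap_eq, tensorHom_gcomp, wl_id, gcomp_eId]

lemma associator_elements {P Q R : V} {X X' Y Y' Z Z' : A} (f : P ⟶ (X ⟶[V] X'))
    (g : Q ⟶ (Y ⟶[V] Y')) (h : R ⟶ (Z ⟶[V] Z')) :
    (((f ⊗ₘ g) ≫ MonoidalVCategory.tensorMap X X' Y Y') ⊗ₘ h) ≫
        MonoidalVCategory.tensorMap (X ⊗ Y) (X' ⊗ Y') Z Z' ≫
        eHomWhiskerLeft V _ (α_ X' Y' Z').hom =
      (α_ P Q R).hom ≫ (f ⊗ₘ ((g ⊗ₘ h) ≫ MonoidalVCategory.tensorMap Y Y' Z Z')) ≫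
        MonoidalVCategory.tensorMap X X' (Y ⊗ Z) (Y' ⊗ Z') ≫
          eHomWhiskerRight V (α_ X Y Z).hom _ := by
  have := congrArg (fun t => ((f ⊗ₘ g) ⊗ₘ h) ≫ t)
    (MonoidalVCategory.associator_natural (V := V) X X' Y Y' Z Z')
  simp only [associator_naturality_assoc, ← tensorHom_id, ← id_tensorHom,
    tensorHom_comp_tensorHom_assoc, Category.comp_id] at this
  exact this

lemma wl_wl_associator (X Y Z Z' : A) :
    wl V (X ⊗ Y) Z Z' ≫ eHomWhiskerLeft V _ (α_ X Y Z').hom =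
      wl V Y Z Z' ≫ wl V X _ _ ≫ eHomWhiskerRight V (α_ X Y Z).hom _ := by
  have := associator_elements V (eId V X) (eId V Y) (𝟙 (Z ⟶[V] Z'))
  rw [eId_tensorMap, eId_tensorMap, wl_id, reassoc_of% eId_tensorMap, Category.id_comp,
    ← Category.comp_id (𝟙 (Z ⟶[V] Z')), ← tensorHom_comp_tensorHom, Category.assoc,
    reassoc_of% eId_tensorMap] at this
  simp only [Category.id_comp, Category.assoc] at this
  rw [← cancel_epi ((λ_ (𝟙_ V)).hom ▷ (Z ⟶[V] Z') ≫ (λ_ (Z ⟶[V] Z')).hom)]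
  simpa using this

lemma wr_wr_associator (X X' Y Z : A) :
    wr V X X' Y ≫ wr V _ _ Z ≫ eHomWhiskerLeft V _ (α_ X' Y Z).hom =
      wr V X X' (Y ⊗ Z) ≫ eHomWhiskerRight V (α_ X Y Z).hom _ := by
  have := associator_elements V (𝟙 (X ⟶[V] X')) (eId V Y) (eId V Z)
  rw [tensorMap_eId, reassoc_of% tensorMap_eId, eId_tensorMap, wl_id] at this
  rw [← cancel_epi ((ρ_ _).hom ≫ (ρ_ (X ⟶[V] X')).hom)]
  have h : (𝟙 (X ⟶[V] X') ⊗ₘ (λ_ (𝟙_ V)).hom ≫ eId V (Y ⊗ Z)) =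
      (𝟙 (X ⟶[V] X') ⊗ₘ (λ_ (𝟙_ V)).hom) ≫ (𝟙 (X ⟶[V] X') ⊗ₘ eId V (Y ⊗ Z)) := by
    rw [tensorHom_comp_tensorHom, Category.id_comp]
  rw [h] at this
  simp only [Category.assoc] at this
  rw [reassoc_of% tensorMap_eId] at this
  simp only [Category.id_comp] at this
  rw [Category.assoc, Category.assoc, this]
  simp [unitors_equal]

lemma wl_wr_associator (X Y Y' Z : A) :
    wl V X Y Y' ≫ wr V _ _ Z ≫ eHomWhiskerLeft V _ (α_ X Y' Z).hom =
      wr V Y Y' Z ≫ wl V X _ _ ≫ eHomWhiskerRight V (α_ X Y Z).hom _ := by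
  have := associator_elements V (eId V X) (𝟙 (Y ⟶[V] Y')) (eId V Z)
  rw [eId_tensorMap, reassoc_of% tensorMap_eId, tensorMap_eId] at this
  rw [reassoc_of% eId_tensorMap] at this
  simp only [Category.id_comp, Category.assoc] at this
  rw [← cancel_epi ((ρ_ _).hom ≫ (λ_ (Y ⟶[V] Y')).hom)]
  rw [Category.assoc, Category.assoc, this]
  have c : (α_ (𝟙_ V) (Y ⟶[V] Y') (𝟙_ V)).hom ≫ (λ_ _).hom ≫ (ρ_ _).hom =
      (ρ_ (𝟙_ V ⊗ (Y ⟶[V] Y'))).hom ≫ (λ_ _).hom := by monoidal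
  rw [reassoc_of% c]

end Monoidal

section Closed

/-- A right closed monoidal `V`-category: every `X ⊗ -` has a right adjoint `V`-functor, presented
by objects `pow X Y = Y ^ X` and evaluations `X ⊗ Y ^ X ⟶ Y` inducing isomorphisms
`A(B, Y ^ X) ≅ A(X ⊗ B, Y)` in `V`. -/
class RightClosed (V : Type u) [Category.{w} V] [MonoidalCategory V] [BraidedCategory V]
    (A : Type u₁) [Category.{v₁} A] [EnrichedOrdinaryCategory V A] [MonoidalCategory A]
    [MonoidalVCategory V A] where
  /-- the object `Y ^ X` -/
  pow (X Y : A) : A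
  /-- the evaluation `e_r : X ⊗ Y ^ X ⟶ Y` -/
  ev (X Y : A) : X ⊗ pow X Y ⟶ Y
  isIso_transpose (X B Y : A) :
    IsIso (wl V X B (pow X Y) ≫ eHomWhiskerLeft V (X ⊗ B) (ev X Y))

variable (V : Type u) [Category.{w} V] [MonoidalCategory V] [BraidedCategory V]
  {A : Type u₁} [Category.{v₁} A] [EnrichedOrdinaryCategory V A] [MonoidalCategory A]
  [MonoidalVCategory V A] [RightClosed V A]

/-- The object `Y ^ X`. -/
abbrev pow (X Y : A) : A := RightClosed.pow V X Y

/-- The evaluation `e_r : X ⊗ Y ^ X ⟶ Y`. -/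
abbrev ev (X Y : A) : X ⊗ pow V X Y ⟶ Y := RightClosed.ev X Y

/-- The isomorphism `A(B, Y ^ X) ≅ A(X ⊗ B, Y)` of the right closed structure. -/
noncomputable def transpose (X B Y : A) : (B ⟶[V] pow V X Y) ≅ ((X ⊗ B) ⟶[V] Y) :=
  @asIso _ _ _ _ _ (RightClosed.isIso_transpose (V := V) X B Y)

lemma transpose_hom (X B Y : A) :
    (transpose V X B Y).hom = wl V X B (pow V X Y) ≫ eHomWhiskerLeft V (X ⊗ B) (ev V X Y) := rfl

/-- The morphism `B ⟶ Y ^ X` corresponding to `f : X ⊗ B ⟶ Y`. -/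
noncomputable def transposeHom {X B Y : A} (f : X ⊗ B ⟶ Y) : B ⟶ pow V X Y :=
  (eHomEquiv V).symm (eHomEquiv V f ≫ (transpose V X B Y).inv)

@[simp]
lemma transposeHom_ev {X B Y : A} (f : X ⊗ B ⟶ Y) : X ◁ transposeHom V f ≫ ev V X Y = f := by
  apply (eHomEquiv V).injective
  rw [← hom_post, ← eHomEquiv_wl, Category.assoc, ← transpose_hom, transposeHom,
    Equiv.apply_symm_apply, Category.assoc, Iso.inv_hom_id, Category.comp_id]

lemma pow_hom_ext {X B Y : A} {f g : B ⟶ pow V X Y} (h : X ◁ f ≫ ev V X Y = X ◁ g ≫ ev V X Y) :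
    f = g := by
  apply (eHomEquiv V).injective
  rw [← cancel_mono (transpose V X B Y).hom, transpose_hom, ← Category.assoc, ← Category.assoc,
    eHomEquiv_wl, eHomEquiv_wl, hom_post, hom_post, h]

lemma transpose_ext {X B Y : A} {P : V} {f g : P ⟶ (B ⟶[V] pow V X Y)}
    (h : f ≫ wl V X B (pow V X Y) ≫ eHomWhiskerLeft V (X ⊗ B) (ev V X Y) =
      g ≫ wl V X B (pow V X Y) ≫ eHomWhiskerLeft V (X ⊗ B) (ev V X Y)) : f = g := by
  rwa [← transpose_hom, cancel_mono] at h

/-- The map `A(Y, Y') ⟶ A(Y ^ X, Y' ^ X)` given by the `V`-functor `(-) ^ X`. -/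
noncomputable def powR (X Y Y' : A) : (Y ⟶[V] Y') ⟶ (pow V X Y ⟶[V] pow V X Y') :=
  eHomWhiskerRight V (ev V X Y) Y' ≫ (transpose V X (pow V X Y) Y').inv

/-- The map `A(X', X) ⟶ A(Y ^ X, Y ^ X')` given by the contravariant `V`-functor `Y ^ (-)`. -/
noncomputable def powL (X' X Y : A) : (X' ⟶[V] X) ⟶ (pow V X Y ⟶[V] pow V X' Y) :=
  (wr V X' X (pow V X Y) ≫ eHomWhiskerLeft V _ (ev V X Y)) ≫ (transpose V X' (pow V X Y) Y).inv

lemma powR_transpose (X Y Y' : A) :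
    powR V X Y Y' ≫ wl V X _ _ ≫ eHomWhiskerLeft V _ (ev V X Y') =
      eHomWhiskerRight V (ev V X Y) Y' := by
  rw [← transpose_hom, powR, Category.assoc, Iso.inv_hom_id, Category.comp_id]

lemma powL_transpose (X' X Y : A) :
    powL V X' X Y ≫ wl V X' _ _ ≫ eHomWhiskerLeft V _ (ev V X' Y) =
      wr V X' X (pow V X Y) ≫ eHomWhiskerLeft V _ (ev V X Y) := by
  rw [← transpose_hom, powL, Category.assoc, Iso.inv_hom_id, Category.comp_id]

lemma powR_id (X Y : A) : eId V Y ≫ powR V X Y Y = eId V (pow V X Y) := by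
  apply transpose_ext
  rw [Category.assoc, powR_transpose, reassoc_of% wl_id, ← eHomEquiv_id, ← eHomEquiv_id,
    hom_pre, hom_post, Category.comp_id, Category.id_comp]

lemma powL_id (X Y : A) : eId V X ≫ powL V X X Y = eId V (pow V X Y) := by
  apply transpose_ext
  rw [Category.assoc, powL_transpose, reassoc_of% wl_id, reassoc_of% wr_id]

lemma powR_comp (X Y Y' Y'' : A) :
    eComp V Y Y' Y'' ≫ powR V X Y Y'' = gcomp (powR V X Y Y') (powR V X Y' Y'') := by
  apply transpose_ext
  rw [Category.assoc, powR_transpose, reassoc_of% gcomp_wl, gcomp_post, Category.assoc,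
    powR_transpose, ← Category.id_comp (eHomWhiskerRight V (ev V X Y') Y''), gcomp_mid,
    Category.assoc, powR_transpose, eComp_eq_gcomp, gcomp_pre, Category.id_comp]

lemma powL_comp (x y z Y : A) :
    (β_ (y ⟶[V] x) (z ⟶[V] y)).hom ≫ eComp V z y x ≫ powL V z x Y =
      gcomp (powL V y x Y) (powL V z y Y) := by
  apply transpose_ext
  have h := gcomp_wl_wr V (powL V y x Y) (𝟙 (z ⟶[V] y))
  rw [Category.id_comp, Category.id_comp] at h
  have e₁ : gcomp (powL V y x Y ≫ wl V z _ _) (powL V z y Y ≫ wl V z _ _) ≫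
      eHomWhiskerLeft V _ (ev V z Y) =
        gcomp (powL V y x Y ≫ wl V z _ _) (wr V z y _) ≫ eHomWhiskerLeft V _ (ev V y Y) := by
    rw [gcomp_post, gcomp_post, Category.assoc, powL_transpose]
  have e₂ : gcomp (wr V z y (pow V x Y)) (powL V y x Y ≫ wl V y _ _) ≫
      eHomWhiskerLeft V _ (ev V y Y) =
        gcomp (wr V z y _) (wr V y x _) ≫ eHomWhiskerLeft V _ (ev V x Y) := by
    rw [gcomp_post, gcomp_post, Category.assoc, powL_transpose]
  rw [Category.assoc, Category.assoc, powL_transpose, reassoc_of% wr_comp,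
    reassoc_of% gcomp_wl, e₁, h, Category.assoc, e₂]

lemma powR_gcomp_powL (X' X Y Y' : A) :
    gcomp (powR V X Y Y') (powL V X' X Y') =
      (β_ (Y ⟶[V] Y') (X' ⟶[V] X)).hom ≫ gcomp (powL V X' X Y) (powR V X' Y Y') := by
  apply transpose_ext
  have h := gcomp_wl_wr V (powR V X Y Y') (𝟙 (X' ⟶[V] X))
  rw [Category.id_comp, Category.id_comp] at h
  have e₁ : gcomp (powR V X Y Y' ≫ wl V X' _ _) (powL V X' X Y' ≫ wl V X' _ _) ≫
      eHomWhiskerLeft V _ (ev V X' Y') =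
        gcomp (powR V X Y Y' ≫ wl V X' _ _) (wr V X' X _) ≫ eHomWhiskerLeft V _ (ev V X Y') := by
    rw [gcomp_post, gcomp_post, Category.assoc, powL_transpose]
  have e₂ : gcomp (wr V X' X (pow V X Y)) (powR V X Y Y' ≫ wl V X _ _) ≫
      eHomWhiskerLeft V _ (ev V X Y') =
        gcomp (wr V X' X _ ≫ eHomWhiskerLeft V _ (ev V X Y)) (𝟙 (Y ⟶[V] Y')) := by
    rw [gcomp_post, Category.assoc, powR_transpose, ← gcomp_mid, Category.id_comp]
  have e₃ : gcomp (powL V X' X Y ≫ wl V X' _ _) (powR V X' Y Y' ≫ wl V X' _ _) ≫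
      eHomWhiskerLeft V _ (ev V X' Y') =
        gcomp (wr V X' X _ ≫ eHomWhiskerLeft V _ (ev V X Y)) (𝟙 (Y ⟶[V] Y')) := by
    rw [gcomp_post, Category.assoc, powR_transpose, ← powL_transpose, ← Category.assoc, ← gcomp_mid,
      Category.id_comp]
  rw [Category.assoc, reassoc_of% gcomp_wl, reassoc_of% gcomp_wl, e₁, e₃, h, Category.assoc, e₂]

/-- The `V`-functor `Aᵒᵖ ⊗ A ⟶ A` sending `(X, Y)` to `Y ^ X`. -/
noncomputable def powVFunctor (A : Type u₁) [Category.{v₁} A] [EnrichedOrdinaryCategory V A]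
    [MonoidalCategory A] [MonoidalVCategory V A] [RightClosed V A] :
    EnrichedFunctor V (TensorCat Aᵒᵖ A) A :=
  mkBifunctor (fun X Y => pow V X.unop Y) (fun X X' Y => powL V X'.unop X.unop Y)
    (fun X Y Y' => powR V X.unop Y Y')
    (fun X Y => powL_id V X.unop Y)
    (fun X Y => powR_id V X.unop Y)
    (fun x y z Y => by
      rw [eComp_op_eq, Category.assoc]
      exact powL_comp V x.unop y.unop z.unop Y)
    (fun X => powR_comp V X.unop)
    (fun X X' Y Y' => powR_gcomp_powL V X'.unop X.unop Y Y')

lemma actL_powVFunctor (X' X Y : A) :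
    actL (powVFunctor V A) (op X) (op X') Y = powL V X' X Y :=
  actL_mkBifunctor _ _ _ _ _ _ _ _ _ _ _

lemma actR_powVFunctor (X Y Y' : A) :
    actR (powVFunctor V A) (op X) Y Y' = powR V X Y Y' :=
  actR_mkBifunctor _ _ _ _ _ _ _ _ _ _ _

/-- The coevaluation `d_r : Y ⟶ (X ⊗ Y) ^ X`. -/
noncomputable def coev (X Y : A) : Y ⟶ pow V X (X ⊗ Y) := transposeHom V (𝟙 (X ⊗ Y))

/-- The morphism `f ^ X : Y ^ X ⟶ Y' ^ X` for `f : Y ⟶ Y'`. -/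
noncomputable def powMap (X : A) {Y Y' : A} (f : Y ⟶ Y') : pow V X Y ⟶ pow V X Y' :=
  (eHomEquiv V).symm (eHomEquiv V f ≫ powR V X Y Y')

@[simp]
lemma powMap_ev (X : A) {Y Y' : A} (f : Y ⟶ Y') :
    X ◁ powMap V X f ≫ ev V X Y' = ev V X Y ≫ f := by
  apply (eHomEquiv V).injective
  rw [← hom_post, ← eHomEquiv_wl, powMap, Equiv.apply_symm_apply, Category.assoc, Category.assoc,
    powR_transpose, hom_pre]

/-- The canonical isomorphism `(Z ^ A) ^ X ≅ Z ^ (A ⊗ X)`. -/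
noncomputable def powPow (B X Z : A) : pow V X (pow V B Z) ≅ pow V (B ⊗ X) Z where
  hom := transposeHom V ((α_ B X _).hom ≫ B ◁ ev V X (pow V B Z) ≫ ev V B Z)
  inv := transposeHom V (transposeHom V ((α_ B X _).inv ≫ ev V (B ⊗ X) Z))
  hom_inv_id := by
    apply pow_hom_ext
    apply pow_hom_ext
    simp only [MonoidalCategory.whiskerLeft_comp, Category.assoc, transposeHom_ev,
      whiskerLeft_id, Category.id_comp]
    rw [associator_inv_naturality_right_assoc, transposeHom_ev, Iso.inv_hom_id_assoc]
  inv_hom_id := by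
    apply pow_hom_ext
    simp only [MonoidalCategory.whiskerLeft_comp, Category.assoc, transposeHom_ev,
      whiskerLeft_id, Category.id_comp]
    rw [associator_naturality_right_assoc, ← MonoidalCategory.whiskerLeft_comp_assoc,
      transposeHom_ev, transposeHom_ev, Iso.hom_inv_id_assoc]

/-- The morphism `(d_r) ^ X : Y ^ X ⟶ ((B ⊗ Y) ^ B) ^ X ≅ (B ⊗ Y) ^ (B ⊗ X)`. -/
noncomputable def coevPow (B X Y : A) : pow V X Y ⟶ pow V (B ⊗ X) (B ⊗ Y) :=
  powMap V X (coev V B Y) ≫ (powPow V B X (B ⊗ Y)).hom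

lemma coevPow_ev (B X Y : A) :
    (B ⊗ X) ◁ coevPow V B X Y ≫ ev V (B ⊗ X) (B ⊗ Y) = (α_ B X _).hom ≫ B ◁ ev V X Y := by
  rw [coevPow, powPow, MonoidalCategory.whiskerLeft_comp, Category.assoc, transposeHom_ev,
    associator_naturality_right_assoc, ← MonoidalCategory.whiskerLeft_comp_assoc, powMap_ev,
    MonoidalCategory.whiskerLeft_comp_assoc, coev, transposeHom_ev, Category.comp_id]

end Closed

section CoevNaturality

variable (V : Type u) [Category.{w} V] [MonoidalCategory V] [BraidedCategory V]
  {A : Type u₁} [Category.{v₁} A] [EnrichedOrdinaryCategory V A] [MonoidalCategory A]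
  [MonoidalVCategory V A] [RightClosed V A]

lemma powR_coevPow (B X Y Y' : A) :
    powR V X Y Y' ≫ eHomWhiskerLeft V _ (coevPow V B X Y') =
      wl V B Y Y' ≫ powR V (B ⊗ X) (B ⊗ Y) (B ⊗ Y') ≫
        eHomWhiskerRight V (coevPow V B X Y) _ := by
  apply transpose_ext
  simp only [Category.assoc]
  rw [← reassoc_of% wl_post, ← reassoc_of% wl_pre, ← eHom_whisker_exchange, reassoc_of% powR_transpose,
    ← eHomWhiskerLeft_comp, ← eHomWhiskerRight_comp, coevPow_ev, coevPow_ev, eHomWhiskerLeft_comp,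
    eHomWhiskerRight_comp, reassoc_of% wl_wl_associator, reassoc_of% wl_pre, ← eHom_whisker_exchange,
    reassoc_of% wl_post, reassoc_of% powR_transpose]

lemma powL_coevPow (B X' X Y : A) :
    powL V X' X Y ≫ eHomWhiskerLeft V _ (coevPow V B X' Y) =
      wl V B X' X ≫ powL V (B ⊗ X') (B ⊗ X) (B ⊗ Y) ≫
        eHomWhiskerRight V (coevPow V B X Y) _ := by
  apply transpose_ext
  simp only [Category.assoc]
  rw [← reassoc_of% wl_post, ← reassoc_of% wl_pre, ← eHom_whisker_exchange, reassoc_of% powL_transpose,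
    eHom_whisker_exchange, reassoc_of% wr_exchange,
    ← eHomWhiskerLeft_comp, ← eHomWhiskerLeft_comp, coevPow_ev, coevPow_ev, eHomWhiskerLeft_comp,
    eHomWhiskerLeft_comp, reassoc_of% wl_wl_associator, reassoc_of% wl_wr_associator,
    ← eHom_whisker_exchange, ← eHom_whisker_exchange, reassoc_of% wl_post, reassoc_of% wl_post,
    reassoc_of% powL_transpose]

lemma coevPow_natural (B B' X Y : A) :
    wr V B B' Y ≫ powR V (B ⊗ X) (B ⊗ Y) (B' ⊗ Y) ≫ eHomWhiskerRight V (coevPow V B X Y) _ =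
      wr V B B' X ≫ powL V (B ⊗ X) (B' ⊗ X) (B' ⊗ Y) ≫
        eHomWhiskerRight V (coevPow V B' X Y) _ := by
  apply transpose_ext
  simp only [Category.assoc]
  rw [← reassoc_of% wl_pre, ← reassoc_of% wl_pre, ← eHom_whisker_exchange, ← eHom_whisker_exchange,
    reassoc_of% powR_transpose, reassoc_of% powL_transpose, eHom_whisker_exchange, reassoc_of% wr_exchange,
    ← eHomWhiskerRight_comp, ← eHomWhiskerLeft_comp, coevPow_ev, coevPow_ev,
    eHomWhiskerLeft_comp, eHomWhiskerRight_comp, reassoc_of% wr_wr_associator,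
    ← eHom_whisker_exchange, reassoc_of% wr_exchange]

/-- The morphism `Y ^ f : Y ^ X ⟶ Y ^ X'` for `f : X' ⟶ X`. -/
noncomputable def powMapL {X' X : A} (f : X' ⟶ X) (Y : A) : pow V X Y ⟶ pow V X' Y :=
  (eHomEquiv V).symm (eHomEquiv V f ≫ powL V X' X Y)

@[simp]
lemma powMapL_ev {X' X : A} (f : X' ⟶ X) (Y : A) :
    X' ◁ powMapL V f Y ≫ ev V X' Y = f ▷ _ ≫ ev V X Y := by
  apply (eHomEquiv V).injective
  rw [← hom_post, ← eHomEquiv_wl, powMapL, Equiv.apply_symm_apply, Category.assoc, Category.assoc,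
    powL_transpose, reassoc_of% eHomEquiv_wr, hom_post]

lemma coevPow_unit (X Y : A) :
    coevPow V (𝟙_ A) X Y ≫ powMap V (𝟙_ A ⊗ X) (λ_ Y).hom = powMapL V (λ_ X).hom Y := by
  apply pow_hom_ext
  rw [MonoidalCategory.whiskerLeft_comp, Category.assoc, powMap_ev, reassoc_of% coevPow_ev, powMapL_ev,
    leftUnitor_naturality, leftUnitor_whiskerRight, Category.assoc]

lemma coevPow_tensor (B B' X Y : A) :
    coevPow V (B ⊗ B') X Y ≫ powMap V ((B ⊗ B') ⊗ X) (α_ B B' Y).hom =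
      coevPow V B' X Y ≫ coevPow V B (B' ⊗ X) (B' ⊗ Y) ≫
        powMapL V (α_ B B' X).hom (B ⊗ B' ⊗ Y) := by
  apply pow_hom_ext
  rw [MonoidalCategory.whiskerLeft_comp, Category.assoc, powMap_ev, reassoc_of% coevPow_ev,
    MonoidalCategory.whiskerLeft_comp, MonoidalCategory.whiskerLeft_comp, Category.assoc,
    Category.assoc, powMapL_ev, whisker_exchange_assoc, whisker_exchange_assoc, coevPow_ev,
    associator_naturality_right_assoc, ← MonoidalCategory.whiskerLeft_comp, coevPow_ev]
  simp

lemma coevPow_ev_powPow (B X Y : A) :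
    coevPow V B X (pow V B Y) ≫ powMap V (B ⊗ X) (ev V B Y) = (powPow V B X Y).hom := by
  apply pow_hom_ext
  rw [MonoidalCategory.whiskerLeft_comp, Category.assoc, powMap_ev, reassoc_of% coevPow_ev, powPow,
    transposeHom_ev]

end CoevNaturality

attribute [instance] MonoidalClosed.enrichedCategorySelf
attribute [instance] MonoidalClosed.enrichedOrdinaryCategorySelf

section Tambara

variable (V : Type u) [Category.{w} V] [MonoidalCategory V] [SymmetricCategory V]
  [MonoidalClosed V]
  (A : Type u₁) [Category.{v₁} A] [EnrichedOrdinaryCategory V A]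

/-- Endomodules of `A`: `V`-functors `Aᵒᵖ ⊗ A ⟶ V`. -/
abbrev Endomodule : Type _ := EnrichedFunctor V (TensorCat Aᵒᵖ A) V

variable {V A}

namespace Endomodule

/-- The object `T(X, Y)`. -/
abbrev hom (T : Endomodule V A) (X Y : A) : V := T.obj ⟨op X, Y⟩

/-- The contravariant action `A(X', X) ⟶ V(T(X, Y), T(X', Y))`. -/
def left (T : Endomodule V A) (X' X Y : A) : (X' ⟶[V] X) ⟶ EnrichedCategory.Hom (V := V) (T.hom X Y) (T.hom X' Y) :=
  actL T (op X) (op X') Y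

/-- The covariant action `A(Y, Y') ⟶ V(T(X, Y), T(X, Y'))`. -/
def right (T : Endomodule V A) (X Y Y' : A) : (Y ⟶[V] Y') ⟶ EnrichedCategory.Hom (V := V) (T.hom X Y) (T.hom X Y') :=
  actR T (op X) Y Y'

/-- The morphism `T(f, Y) : T(X, Y) ⟶ T(X', Y)` for `f : X' ⟶ X`. -/
def mapLeft (T : Endomodule V A) {X' X : A} (f : X' ⟶ X) (Y : A) : T.hom X Y ⟶ T.hom X' Y :=
  (eHomEquiv V).symm (eHomEquiv V f ≫ T.left X' X Y)

/-- The morphism `T(X, g) : T(X, Y) ⟶ T(X, Y')` for `g : Y ⟶ Y'`. -/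
def mapRight (T : Endomodule V A) (X : A) {Y Y' : A} (g : Y ⟶ Y') : T.hom X Y ⟶ T.hom X Y' :=
  (eHomEquiv V).symm (eHomEquiv V g ≫ T.right X Y Y')

end Endomodule

variable (V A) [MonoidalCategory A] [MonoidalVCategory V A]

/-- Left Tambara modules on `A`. -/
structure LeftTambara where
  /-- the endomodule `T` -/
  T : Endomodule V A
  /-- the structure morphisms `α_l(B, X, Y) : T(X, Y) ⟶ T(B ⊗ X, B ⊗ Y)` -/
  act (B X Y : A) : T.hom X Y ⟶ T.hom (B ⊗ X) (B ⊗ Y)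
  /-- `V`-naturality in `X` -/
  natural_left (B X' X Y : A) :
    T.left X' X Y ≫ eHomWhiskerLeft V (T.hom X Y) (act B X' Y) =
      wl V B X' X ≫ T.left (B ⊗ X') (B ⊗ X) (B ⊗ Y) ≫
        eHomWhiskerRight V (act B X Y) (T.hom (B ⊗ X') (B ⊗ Y))
  /-- `V`-naturality in `Y` -/
  natural_right (B X Y Y' : A) :
    T.right X Y Y' ≫ eHomWhiskerLeft V (T.hom X Y) (act B X Y') =
      wl V B Y Y' ≫ T.right (B ⊗ X) (B ⊗ Y) (B ⊗ Y') ≫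
        eHomWhiskerRight V (act B X Y) (T.hom (B ⊗ X) (B ⊗ Y'))
  /-- (extraordinary) `V`-naturality in `B` -/
  natural_act (B B' X Y : A) :
    wr V B B' Y ≫ T.right (B ⊗ X) (B ⊗ Y) (B' ⊗ Y) ≫
        eHomWhiskerRight V (act B X Y) (T.hom (B ⊗ X) (B' ⊗ Y)) =
      wr V B B' X ≫ T.left (B ⊗ X) (B' ⊗ X) (B' ⊗ Y) ≫
        eHomWhiskerRight V (act B' X Y) (T.hom (B ⊗ X) (B' ⊗ Y))
  act_unit (X Y : A) :
    act (𝟙_ A) X Y ≫ T.mapRight (𝟙_ A ⊗ X) (λ_ Y).hom = T.mapLeft (λ_ X).hom Y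
  act_tensor (B B' X Y : A) :
    act (B ⊗ B') X Y ≫ T.mapRight ((B ⊗ B') ⊗ X) (α_ B B' Y).hom =
      act B' X Y ≫ act B (B' ⊗ X) (B' ⊗ Y) ≫ T.mapLeft (α_ B B' X).hom (B ⊗ B' ⊗ Y)

variable {V A}

/-- The morphism `β_l(B, X, Y) : T(X, Y ^ B) ⟶ T(B ⊗ X, Y)` corresponding to `α_l`. -/
def LeftTambara.beta [RightClosed V A] (M : LeftTambara V A) (B X Y : A) :
    M.T.hom X (pow V B Y) ⟶ M.T.hom (B ⊗ X) Y :=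
  M.act B X (pow V B Y) ≫ M.T.mapRight (B ⊗ X) (ev V B Y)

/-- A left Tambara module is strong if all `β_l(B, X, Y)` are invertible. -/
def LeftTambara.IsStrong [RightClosed V A] (M : LeftTambara V A) : Prop :=
  ∀ B X Y : A, IsIso (M.beta B X Y)

end Tambara

section TambaraHom

variable {V : Type u} [Category.{w} V] [MonoidalCategory V] [SymmetricCategory V]
  [MonoidalClosed V] [HasLimits V]
  {A : Type w} [Category.{v₁} A] [EnrichedOrdinaryCategory V A] [MonoidalCategory A]
  [MonoidalVCategory V A]

/-- The projection `pr_{X, Y} : [Aᵒᵖ ⊗ A, V](T, T') ⟶ V(T(X, Y), T'(X, Y))`. -/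
noncomputable abbrev Endomodule.pr (T T' : Endomodule V A) (X Y : A) :
    (T ⟶[V] T') ⟶ EnrichedCategory.Hom (V := V) (T.hom X Y) (T'.hom X Y) :=
  Tambara.pr T T' ⟨op X, Y⟩

namespace LeftTambara

/-- The family of maps `V(α_l, 1) ∘ pr_{B ⊗ X, B ⊗ Y}`. -/
noncomputable def homL (M N : LeftTambara V A) :
    (M.T ⟶[V] N.T) ⟶
      ∏ᶜ fun p : A × A × A => EnrichedCategory.Hom (V := V)
        (M.T.hom p.2.1 p.2.2) (N.T.hom (p.1 ⊗ p.2.1) (p.1 ⊗ p.2.2)) :=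
  Pi.lift fun p => M.T.pr N.T (p.1 ⊗ p.2.1) (p.1 ⊗ p.2.2) ≫
    eHomWhiskerRight V (M.act p.1 p.2.1 p.2.2) _

/-- The family of maps `V(1, α_l) ∘ pr_{X, Y}`. -/
noncomputable def homR (M N : LeftTambara V A) :
    (M.T ⟶[V] N.T) ⟶
      ∏ᶜ fun p : A × A × A => EnrichedCategory.Hom (V := V)
        (M.T.hom p.2.1 p.2.2) (N.T.hom (p.1 ⊗ p.2.1) (p.1 ⊗ p.2.2)) :=
  Pi.lift fun p => M.T.pr N.T p.2.1 p.2.2 ≫ eHomWhiskerLeft V _ (N.act p.1 p.2.1 p.2.2)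

/-- The hom-object `LTamb(A)(M, N)`: the joint equalizer, over all `B`, `X`, `Y`, of the two maps
`[Aᵒᵖ ⊗ A, V](M, N) ⟶ V(M(X, Y), N(B ⊗ X, B ⊗ Y))`. -/
noncomputable abbrev homObj (M N : LeftTambara V A) : V := equalizer (homL M N) (homR M N)

/-- Compatibility of `φ : P ⟶ [Aᵒᵖ ⊗ A, V](M, N)` with the actions. -/
def Compat (M N : LeftTambara V A) {P : V} (φ : P ⟶ (M.T ⟶[V] N.T)) : Prop :=
  ∀ B X Y : A, φ ≫ M.T.pr N.T (B ⊗ X) (B ⊗ Y) ≫ eHomWhiskerRight V (M.act B X Y) _ =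
    φ ≫ M.T.pr N.T X Y ≫ eHomWhiskerLeft V _ (N.act B X Y)

lemma compat_iff (M N : LeftTambara V A) {P : V} (φ : P ⟶ (M.T ⟶[V] N.T)) :
    φ ≫ homL M N = φ ≫ homR M N ↔ Compat M N φ := by
  constructor
  · intro h B X Y
    have := congrArg (fun t => t ≫ Pi.π _ (B, X, Y)) h
    simp only [homL, homR, Category.assoc] at this
    erw [Pi.lift_π, Pi.lift_π] at this
    exact this
  · intro h
    refine Pi.hom_ext _ _ fun p => ?_
    simp only [homL, homR, Category.assoc]
    rw [Pi.lift_π, Pi.lift_π]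
    exact h p.1 p.2.1 p.2.2

lemma compat_eId (M : LeftTambara V A) : Compat M M (eId V M.T) := fun B X Y => by
  rw [reassoc_of% eId_pr, reassoc_of% eId_pr, ← eHomEquiv_id, ← eHomEquiv_id, hom_pre, hom_post,
    Category.comp_id, Category.id_comp]

lemma Compat.gcomp {M N K : LeftTambara V A} {P Q : V} {φ : P ⟶ (M.T ⟶[V] N.T)}
    {ψ : Q ⟶ (N.T ⟶[V] K.T)} (h : Compat M N φ) (k : Compat N K ψ) :
    Compat M K (gcomp φ ψ) := fun B X Y => by
  have e (X Y : A) : Tambara.gcomp φ ψ ≫ M.T.pr K.T X Y =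
      Tambara.gcomp (φ ≫ M.T.pr N.T X Y) (ψ ≫ N.T.pr K.T X Y) := by
    rw [Tambara.gcomp, Category.assoc, eComp_pr, tensorHom_gcomp]
  rw [reassoc_of% e, reassoc_of% e, gcomp_pre, gcomp_post, Category.assoc, Category.assoc, h B X Y,
    ← k B X Y, ← Category.assoc ψ, gcomp_mid, Category.assoc]

/-- The `V`-category `LTamb(A)` of left Tambara modules. -/
noncomputable instance : EnrichedCategory V (LeftTambara V A) where
  Hom M N := homObj M N
  id M := equalizer.lift (eId V M.T) ((compat_iff _ _ _).2 (compat_eId M))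
  comp M N K := equalizer.lift (gcomp (equalizer.ι (homL M N) (homR M N)) (equalizer.ι _ _))
    ((compat_iff _ _ _).2 (Compat.gcomp ((compat_iff _ _ _).1 (equalizer.condition _ _))
      ((compat_iff _ _ _).1 (equalizer.condition _ _))))
  id_comp M N := by
    refine equalizer.hom_ext ?_
    rw [Category.assoc, Category.assoc, equalizer.lift_ι, whiskerRight_gcomp, equalizer.lift_ι,
      eId_gcomp, Iso.inv_hom_id_assoc, Category.id_comp]
  comp_id M N := by
    refine equalizer.hom_ext ?_
    rw [Category.assoc, Category.assoc, equalizer.lift_ι, whiskerLeft_gcomp, equalizer.lift_ι,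
      gcomp_eId, Iso.inv_hom_id_assoc, Category.id_comp]
  assoc M N K L := by
    refine equalizer.hom_ext ?_
    rw [Category.assoc, Category.assoc, Category.assoc, equalizer.lift_ι, equalizer.lift_ι,
      whiskerRight_gcomp, whiskerLeft_gcomp, equalizer.lift_ι, equalizer.lift_ι, gcomp_assoc,
      Iso.inv_hom_id_assoc]

/-- The inclusion `ι : LTamb(A)(M, N) ⟶ [Aᵒᵖ ⊗ A, V](M, N)`. -/
noncomputable def ι (M N : LeftTambara V A) : (M ⟶[V] N) ⟶ (M.T ⟶[V] N.T) :=
  equalizer.ι (homL M N) (homR M N)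

lemma hom_ext {M N : LeftTambara V A} {P : V} {f g : P ⟶ (M ⟶[V] N)}
    (h : f ≫ ι M N = g ≫ ι M N) : f = g :=
  equalizer.hom_ext h

/-- The universal property of `LTamb(A)(M, N)`. -/
noncomputable def lift {M N : LeftTambara V A} {P : V} (φ : P ⟶ (M.T ⟶[V] N.T))
    (h : Compat M N φ) : P ⟶ (M ⟶[V] N) :=
  equalizer.lift φ ((compat_iff M N φ).2 h)

lemma lift_ι {M N : LeftTambara V A} {P : V} (φ : P ⟶ (M.T ⟶[V] N.T)) (h : Compat M N φ) :
    lift φ h ≫ ι M N = φ :=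
  equalizer.lift_ι _ _

/-- The forgetful `V`-functor `ι : LTamb(A) ⟶ [Aᵒᵖ ⊗ A, V]`. -/
noncomputable def forget : EnrichedFunctor V (LeftTambara V A) (Endomodule V A) where
  obj M := M.T
  map M N := ι M N
  map_id _ := equalizer.lift_ι _ _
  map_comp _ _ _ := equalizer.lift_ι _ _

end LeftTambara

variable (V A) in
/-- Strong left Tambara modules on `A`. -/
structure StrongLeftTambara [RightClosed V A] extends LeftTambara V A where
  isStrong : toLeftTambara.IsStrong

namespace StrongLeftTambara

variable [RightClosed V A]

/-- The `V`-category `LTamb_s(A)`, a full sub-`V`-category of `LTamb(A)`. -/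
noncomputable instance : EnrichedCategory V (StrongLeftTambara V A) where
  Hom M N := M.toLeftTambara ⟶[V] N.toLeftTambara
  id M := eId V M.toLeftTambara
  comp M N K := eComp V M.toLeftTambara N.toLeftTambara K.toLeftTambara
  id_comp _ _ := e_id_comp _ _ _
  comp_id _ _ := e_comp_id _ _ _
  assoc _ _ _ _ := e_assoc _ _ _ _ _

/-- The inclusion `LTamb_s(A) ⟶ LTamb(A)`. -/
noncomputable def inclusion : EnrichedFunctor V (StrongLeftTambara V A) (LeftTambara V A) where
  obj M := M.toLeftTambara
  map M N := 𝟙 (M.toLeftTambara ⟶[V] N.toLeftTambara)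
  map_id _ := Category.comp_id _
  map_comp M N K := (Category.comp_id _).trans ((Category.id_comp _).symm.trans
    (congrArg (· ≫ eComp V M.toLeftTambara N.toLeftTambara K.toLeftTambara)
      (id_tensorHom_id _ _).symm))

end StrongLeftTambara

end TambaraHom

section Cayley

variable {V : Type u} [Category.{w} V] [MonoidalCategory V] [SymmetricCategory V]
  [MonoidalClosed V]

section MapHom

variable {A : Type u₁} [Category.{v₁} A] [EnrichedOrdinaryCategory V A]

/-- The morphism `F f : F X ⟶ F Y` of `V` for a `V`-functor `F : A ⟶ V` and `f : X ⟶ Y`. -/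
def mapHom (F : EnrichedFunctor V A V) {X Y : A} (f : X ⟶ Y) : F.obj X ⟶ F.obj Y :=
  (eHomEquiv V).symm (eHomEquiv V f ≫ F.map X Y)

lemma eHomEquiv_mapHom (F : EnrichedFunctor V A V) {X Y : A} (f : X ⟶ Y) :
    eHomEquiv V (mapHom F f) = eHomEquiv V f ≫ F.map X Y :=
  Equiv.apply_symm_apply _ _

lemma mapHom_id (F : EnrichedFunctor V A V) (X : A) : mapHom F (𝟙 X) = 𝟙 (F.obj X) := by
  apply (eHomEquiv V).injective
  rw [eHomEquiv_mapHom, eHomEquiv_id, eHomEquiv_id, F.map_id]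

lemma mapHom_comp (F : EnrichedFunctor V A V) {X Y Z : A} (f : X ⟶ Y) (g : Y ⟶ Z) :
    mapHom F (f ≫ g) = mapHom F f ≫ mapHom F g := by
  apply (eHomEquiv V).injective
  rw [eHomEquiv_mapHom, eHomEquiv_comp, eHomEquiv_comp, eHomEquiv_mapHom, eHomEquiv_mapHom,
    Category.assoc, Category.assoc, F.map_comp, tensorHom_comp_tensorHom_assoc]

lemma map_post (F : EnrichedFunctor V A V) (X : A) {Y Z : A} (g : Y ⟶ Z) :
    F.map X Y ≫ eHomWhiskerLeft V _ (mapHom F g) = eHomWhiskerLeft V X g ≫ F.map X Z := by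
  rw [comp_post, eHomWhiskerLeft, Category.assoc, Category.assoc, F.map_comp, eHomEquiv_mapHom,
    ← id_tensorHom, tensorHom_comp_tensorHom_assoc, Category.id_comp]
  rfl

lemma map_pre (F : EnrichedFunctor V A V) {X Y : A} (f : X ⟶ Y) (Z : A) :
    F.map Y Z ≫ eHomWhiskerRight V (mapHom F f) _ = eHomWhiskerRight V f Z ≫ F.map X Z := by
  rw [comp_pre, eHomWhiskerRight, Category.assoc, Category.assoc, F.map_comp, eHomEquiv_mapHom,
    ← tensorHom_id, tensorHom_comp_tensorHom_assoc, Category.id_comp]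
  rfl

end MapHom

section Objects

variable {A : Type u₁} [Category.{v₁} A] [EnrichedOrdinaryCategory V A] [MonoidalCategory A]
  [MonoidalVCategory V A] [RightClosed V A]

/-- The endomodule `T_F(X, Y) = F(Y ^ X)`. -/
noncomputable abbrev cayleyObj (F : EnrichedFunctor V A V) : Endomodule V A :=
  (powVFunctor V A).comp V F

lemma cayleyObj_left (F : EnrichedFunctor V A V) (X' X Y : A) :
    (cayleyObj F).left X' X Y = powL V X' X Y ≫ F.map (pow V X Y) (pow V X' Y) := by
  rw [← actL_powVFunctor]
  exact (Category.assoc _ _ _).symm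

lemma cayleyObj_right (F : EnrichedFunctor V A V) (X Y Y' : A) :
    (cayleyObj F).right X Y Y' = powR V X Y Y' ≫ F.map (pow V X Y) (pow V X Y') := by
  rw [← actR_powVFunctor]
  exact (Category.assoc _ _ _).symm

lemma cayleyObj_mapLeft (F : EnrichedFunctor V A V) {X' X : A} (f : X' ⟶ X) (Y : A) :
    (cayleyObj F).mapLeft f Y = mapHom F (powMapL V f Y) := by
  rw [Endomodule.mapLeft, mapHom, powMapL, Equiv.apply_symm_apply, cayleyObj_left, Category.assoc]
  rfl

lemma cayleyObj_mapRight (F : EnrichedFunctor V A V) (X : A) {Y Y' : A} (g : Y ⟶ Y') :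
    (cayleyObj F).mapRight X g = mapHom F (powMap V X g) := by
  rw [Endomodule.mapRight, mapHom, powMap, Equiv.apply_symm_apply, cayleyObj_right, Category.assoc]
  rfl

lemma cayley_natural_left (F : EnrichedFunctor V A V) (B X' X Y : A) :
    (powL V X' X Y ≫ F.map (pow V X Y) (pow V X' Y)) ≫
        eHomWhiskerLeft V _ (mapHom F (coevPow V B X' Y)) =
      wl V B X' X ≫ (powL V (B ⊗ X') (B ⊗ X) (B ⊗ Y) ≫ F.map _ _) ≫
        eHomWhiskerRight V (mapHom F (coevPow V B X Y)) _ := by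
  rw [Category.assoc, Category.assoc, map_post, map_pre, ← Category.assoc, powL_coevPow,
    Category.assoc, Category.assoc]

lemma cayley_natural_right (F : EnrichedFunctor V A V) (B X Y Y' : A) :
    (powR V X Y Y' ≫ F.map (pow V X Y) (pow V X Y')) ≫
        eHomWhiskerLeft V _ (mapHom F (coevPow V B X Y')) =
      wl V B Y Y' ≫ (powR V (B ⊗ X) (B ⊗ Y) (B ⊗ Y') ≫ F.map _ _) ≫
        eHomWhiskerRight V (mapHom F (coevPow V B X Y)) _ := by
  rw [Category.assoc, Category.assoc, map_post, map_pre, ← Category.assoc, powR_coevPow,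
    Category.assoc, Category.assoc]

lemma cayley_natural_act (F : EnrichedFunctor V A V) (B B' X Y : A) :
    wr V B B' Y ≫ (powR V (B ⊗ X) (B ⊗ Y) (B' ⊗ Y) ≫ F.map _ _) ≫
        eHomWhiskerRight V (mapHom F (coevPow V B X Y)) _ =
      wr V B B' X ≫ (powL V (B ⊗ X) (B' ⊗ X) (B' ⊗ Y) ≫ F.map _ _) ≫
        eHomWhiskerRight V (mapHom F (coevPow V B' X Y)) _ := by
  have h := congrArg (fun t => t ≫ F.map _ _) (coevPow_natural V B B' X Y)
  simp only [Category.assoc] at h ⊢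
  rw [map_pre, map_pre, h]

/-- The left Tambara module `T_F`, with structure morphisms `F((d_r) ^ X)`. -/
noncomputable def cayleyTambara (F : EnrichedFunctor V A V) : LeftTambara V A where
  T := cayleyObj F
  act B X Y := mapHom F (coevPow V B X Y)
  natural_left B X' X Y := by
    rw [cayleyObj_left, cayleyObj_left]
    exact cayley_natural_left F B X' X Y
  natural_right B X Y Y' := by
    rw [cayleyObj_right, cayleyObj_right]
    exact cayley_natural_right F B X Y Y'
  natural_act B B' X Y := by
    rw [cayleyObj_right, cayleyObj_left]
    exact cayley_natural_act F B B' X Y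
  act_unit X Y := by
    rw [cayleyObj_mapLeft, cayleyObj_mapRight, ← coevPow_unit, mapHom_comp]
    rfl
  act_tensor B B' X Y := by
    have h := congrArg (mapHom F) (coevPow_tensor V B B' X Y)
    rw [mapHom_comp, mapHom_comp, mapHom_comp] at h
    rw [cayleyObj_mapLeft, cayleyObj_mapRight]
    exact h

lemma cayleyTambara_beta (F : EnrichedFunctor V A V) (B X Y : A) :
    (cayleyTambara F).beta B X Y = mapHom F (powPow V B X Y).hom := by
  rw [← coevPow_ev_powPow, mapHom_comp]
  change mapHom F (coevPow V B X (pow V B Y)) ≫ (cayleyObj F).mapRight (B ⊗ X) (ev V B Y) = _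
  rw [cayleyObj_mapRight]
  rfl

lemma cayleyTambara_isStrong (F : EnrichedFunctor V A V) : (cayleyTambara F).IsStrong :=
  fun B X Y => by
    have h : mapHom F (powPow V B X Y).hom ≫ mapHom F (powPow V B X Y).inv = 𝟙 _ := by
      rw [← mapHom_comp, Iso.hom_inv_id, mapHom_id]
    have k : mapHom F (powPow V B X Y).inv ≫ mapHom F (powPow V B X Y).hom = 𝟙 _ := by
      rw [← mapHom_comp, Iso.inv_hom_id, mapHom_id]
    rw [cayleyTambara_beta]
    exact ⟨mapHom F (powPow V B X Y).inv, h, k⟩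

end Objects

variable [HasLimits V]
  {A : Type w} [Category.{v₁} A] [EnrichedOrdinaryCategory V A] [MonoidalCategory A]
  [MonoidalVCategory V A] [RightClosed V A]

variable (V A) in
/-- The Cayley `V`-functor `Υ : [A, V] ⟶ [Aᵒᵖ ⊗ A, V]`, with `Υ(F)(X, Y) = F(Y ^ X)` and
`pr_{X, Y} ∘ Υ = pr_{Y ^ X}` on homs. -/
noncomputable def cayley : EnrichedFunctor V (EnrichedFunctor V A V) (Endomodule V A) :=
  precompose (powVFunctor V A)

lemma pr_mapHom (F G : EnrichedFunctor V A V) {X Y : A} (f : X ⟶ Y) :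
    pr F G Y ≫ eHomWhiskerRight V (mapHom F f) (G.obj Y) =
      pr F G X ≫ eHomWhiskerLeft V (F.obj X) (mapHom G f) := by
  have h := isVNatural_pr F G X Y
  rw [comp_pre, comp_post, eHomEquiv_mapHom, eHomEquiv_mapHom, ← whiskerRight_gcomp, h,
    ← whiskerLeft_gcomp, braiding_naturality_left_assoc]
  simp

lemma cayley_compat (F G : EnrichedFunctor V A V) :
    LeftTambara.Compat (cayleyTambara F) (cayleyTambara G) ((cayley V A).map F G) :=
  fun B X Y => by
    have e (X Y : A) : (cayley V A).map F G ≫ Endomodule.pr (cayleyObj F) (cayleyObj G) X Y =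
        pr F G (pow V X Y) := precomposeMap_pr (powVFunctor V A) F G ⟨op X, Y⟩
    refine (Category.assoc _ _ _).symm.trans ((congrArg (· ≫ _) (e (B ⊗ X) (B ⊗ Y))).trans
      ((pr_mapHom F G (coevPow V B X Y)).trans ?_))
    exact ((congrArg (· ≫ _) (e X Y)).symm.trans (Category.assoc _ _ _))

variable (V A) in
/-- The lifted Cayley `V`-functor `[A, V] ⟶ LTamb_s(A)`. -/
noncomputable def cayleyHat : EnrichedFunctor V (EnrichedFunctor V A V) (StrongLeftTambara V A) where
  obj F := ⟨cayleyTambara F, cayleyTambara_isStrong F⟩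
  map F G := LeftTambara.lift ((cayley V A).map F G) (cayley_compat F G)
  map_id F := LeftTambara.hom_ext ((Category.assoc _ _ _).trans
    ((congrArg (eId V F ≫ ·) (LeftTambara.lift_ι _ _)).trans
      (((cayley V A).map_id F).trans (LeftTambara.forget.map_id (cayleyTambara F)).symm)))
  map_comp F G H := LeftTambara.hom_ext <| by
    refine (Category.assoc _ _ _).trans ((congrArg (eComp V F G H ≫ ·)
      (LeftTambara.lift_ι _ (cayley_compat F H))).trans (((cayley V A).map_comp F G H).trans
        (Eq.trans ?_ ((congrArg (_ ≫ ·) (LeftTambara.forget.map_comp (cayleyTambara F)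
          (cayleyTambara G) (cayleyTambara H)).symm).trans (Category.assoc _ _ _).symm))))
    refine Eq.trans ?_ ((congrArg (· ≫ eComp V (cayleyObj F) (cayleyObj G) (cayleyObj H))
      (tensorHom_comp_tensorHom _ _ _ _).symm).trans (Category.assoc _ _ _))
    exact congrArg₂ (fun a b => (a ⊗ₘ b) ≫ eComp V (cayleyObj F) (cayleyObj G) (cayleyObj H))
      (LeftTambara.lift_ι _ (cayley_compat F G)).symm
      (LeftTambara.lift_ι _ (cayley_compat G H)).symm

/-- The lift satisfies `ι ∘ Υ̂ = Υ` on homs. -/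
lemma cayleyHat_map_ι (F G : EnrichedFunctor V A V) :
    (cayleyHat V A).map F G ≫ LeftTambara.ι (cayleyTambara F) (cayleyTambara G) =
      (cayley V A).map F G :=
  LeftTambara.lift_ι _ (cayley_compat F G)

end Cayley

end Tambara

namespace Tambara

/-! ### Isomorphisms as elements of hom-objects. -/

section Iso

variable {V : Type u} [Category.{w} V] [MonoidalCategory V]
  {D : Type u₂} [Category.{v} D] [EnrichedOrdinaryCategory V D]

/-! A strong left Tambara module is determined by its values at the unit in the first variable.
Taking `Y ^ B` for `B ⊗ -` in the covariant slot, strength says T(X, Y^B) ≅ T(B ⊗ X, Y); at X = I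
this reads T(I, Y^B) ≅ T(B ⊗ I, Y) ≅ T(B, Y). So the inverse of the Cayley functor is Φ(T) = T(I,
-), acting on homs by restriction to the components with first index I.

The composite of the Cayley functor followed by Φ sends F to Y ↦ F(Y^I), and the unit of the
equivalence is F applied to Y ≅ Y^I; its naturality in Y is `powR_powUnit`, and in F it is the
naturality of elements of [A, V](F, G) (`pr_mapHom`).

The counit has components `counitHom`, namely β_l(X, I, Y) followed by T(ρ⁻¹, 1). Four facts about
it carry the proof. It is invertible by strength (`isIso_counitHom`). It is V-natural in X and Y
(`isVNatural_counitHom`): the delicate variable is X, which occurs as an exponent in T(I, Y^X) and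
for which the extraordinary naturality of α_l in its parameter is needed. It commutes with the
actions (`counitHom_act`), by the associativity axiom of a Tambara module with I in the last slot.
Finally it is V-natural in T (`ι_counitHom`), because it is built only from α_l and from values of T
on morphisms, all of which the hom-objects of LTamb respect.

Since isomorphisms of V-functors into a functor V-category can be given componentwise, the counit is
first built after forgetting to [Aᵒᵖ ⊗ A, V]. It then lifts to LTamb_s because the forgetful
V-functor is monic on homs and the components and their inverses are compatible with the actions. -/

lemma gcomp_eHomEquiv_iso {x y : D} (e : x ≅ y) :
    (λ_ (𝟙_ V)).inv ≫ gcomp (eHomEquiv V e.hom) (eHomEquiv V e.inv) = eId V x := by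
  rw [gcomp, ← eHomEquiv_comp, Iso.hom_inv_id, eHomEquiv_id]

end Iso

/-! ### Criteria for V-naturality. -/

section Naturality

variable {V : Type u} [Category.{w} V] [MonoidalCategory V] [SymmetricCategory V]

section Ordinary

variable {C : Type u₁} [EnrichedCategory V C]
  {D : Type u₂} [Category.{v} D] [EnrichedOrdinaryCategory V D]

/-- `V`-naturality of a family of morphisms of the underlying category. -/
lemma isVNatural_eHomEquiv_iff {F G : EnrichedFunctor V C D} (f : ∀ c, F.obj c ⟶ G.obj c) :
    IsVNatural (F := F) (G := G) (fun c => eHomEquiv V (f c)) ↔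
      ∀ c d, F.map c d ≫ eHomWhiskerLeft V _ (f d) = G.map c d ≫ eHomWhiskerRight V (f c) _ := by
  refine forall₂_congr fun c d => ?_
  rw [comp_post, comp_pre, Iso.inv_comp_eq, braiding_tensorUnit_right]
  simp

/-- Conjugating the naturality square by the inverses on both sides turns it into the square for the
inverses, so invertible components suffice. -/
lemma isVNatural_eHomEquiv_inv {F G : EnrichedFunctor V C D} (f : ∀ c, F.obj c ≅ G.obj c)
    (h : IsVNatural (F := F) (G := G) (fun c => eHomEquiv V (f c).hom)) :
    IsVNatural (F := G) (G := F) (fun c => eHomEquiv V (f c).inv) := by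
  rw [isVNatural_eHomEquiv_iff] at h ⊢
  intro c d
  have := congrArg (fun t => t ≫ eHomWhiskerRight V (f c).inv _ ≫ eHomWhiskerLeft V _ (f d).inv)
    (h c d)
  simp only [Category.assoc] at this
  rw [← eHomWhiskerRight_comp_assoc, Iso.inv_hom_id, eHomWhiskerRight_id, Category.id_comp,
    eHom_whisker_exchange_assoc, ← eHomWhiskerLeft_comp, Iso.hom_inv_id, eHomWhiskerLeft_id,
    Category.comp_id] at this
  exact this.symm

end Ordinary

/-- `V`-naturality in two variables may be checked in each variable separately. -/
lemma isVNatural_of_actL_actR {C : Type u₁} [EnrichedCategory V C] {D : Type u₂}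
    [EnrichedCategory V D] {E : Type u₃} [EnrichedCategory V E]
    {F G : EnrichedFunctor V (TensorCat C D) E} {P : V}
    (φ : ∀ p, P ⟶ (F.obj p ⟶[V] G.obj p))
    (hl : ∀ c c' d, gcomp (actL F c c' d) (φ ⟨c', d⟩) =
      (β_ (c ⟶[V] c') P).hom ≫ gcomp (φ ⟨c, d⟩) (actL G c c' d))
    (hr : ∀ c d d', gcomp (actR F c d d') (φ ⟨c, d'⟩) =
      (β_ (d ⟶[V] d') P).hom ≫ gcomp (φ ⟨c, d⟩) (actR G c d d')) :
    IsVNatural (F := F) (G := G) φ := by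
  rintro ⟨c, d⟩ ⟨c', d'⟩
  change gcomp (F.map ⟨c, d⟩ ⟨c', d'⟩) (φ ⟨c', d'⟩) =
    (β_ ((c ⟶[V] c') ⊗ (d ⟶[V] d')) P).hom ≫ gcomp (φ ⟨c, d⟩) (G.map ⟨c, d⟩ ⟨c', d'⟩)
  -- A hom of the tensor product acts through its first factor and then its second. The element φ is
  -- carried past the second factor by `hr`, then past the first by `hl`; the hexagon identity
  -- merges the two braidings into one.
  rw [← actL_gcomp_actR, ← actL_gcomp_actR]
  have e₁ := gcomp_assoc (actL F c c' d) (φ ⟨c', d⟩) (actR G c' d d')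
  rw [← Iso.inv_comp_eq] at e₁
  rw [gcomp_assoc, hr, ← whiskerLeft_gcomp, ← e₁, hl, ← whiskerRight_gcomp, gcomp_assoc,
    braiding_tensor_left_hom]
  simp

/-- `V`-naturality in two variables of a family of morphisms of the underlying category. -/
lemma isVNatural_eHomEquiv_of_actL_actR {C : Type u₁} [EnrichedCategory V C] {D : Type u₂}
    [EnrichedCategory V D] {E : Type u₃} [Category.{v} E] [EnrichedOrdinaryCategory V E]
    {F G : EnrichedFunctor V (TensorCat C D) E} (f : ∀ p, F.obj p ⟶ G.obj p)
    (hl : ∀ c c' d, actL F c c' d ≫ eHomWhiskerLeft V _ (f ⟨c', d⟩) =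
      actL G c c' d ≫ eHomWhiskerRight V (f ⟨c, d⟩) _)
    (hr : ∀ c d d', actR F c d d' ≫ eHomWhiskerLeft V _ (f ⟨c, d'⟩) =
      actR G c d d' ≫ eHomWhiskerRight V (f ⟨c, d⟩) _) :
    IsVNatural (F := F) (G := G) (fun p => eHomEquiv V (f p)) := by
  refine isVNatural_of_actL_actR _ (fun c c' d => ?_) (fun c d d' => ?_)
  · have h := hl c c' d
    rw [comp_post, comp_pre, Iso.inv_comp_eq] at h
    rw [h, braiding_tensorUnit_right, Category.assoc]
  · have h := hr c d d'
    rw [comp_post, comp_pre, Iso.inv_comp_eq] at h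
    rw [h, braiding_tensorUnit_right, Category.assoc]

end Naturality

/-! ### Whiskering in the opposite V-category. -/

section Opposite

variable {V : Type u} [Category.{w} V] [MonoidalCategory V] [BraidedCategory V]
  {A : Type u₁} [Category.{v₁} A] [EnrichedOrdinaryCategory V A]

/-- Composition in Aᵒᵖ is the composition of A preceded by the braiding. As a morphism f is an
element indexed by the unit of V, the braiding reduces to unitors. This and `eHomWhiskerLeft_op`
transfer the calculus of V-functors to contravariant variables. -/
lemma eHomWhiskerRight_op {X Y : A} (f : X ⟶ Y) (Z : A) :
    eHomWhiskerRight V f.op (op Z) = eHomWhiskerLeft V Z f := by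
  change (λ_ (Z ⟶[V] X)).inv ≫ eHomEquiv V f ▷ (Z ⟶[V] X) ≫ (β_ _ _).hom ≫ eComp V Z X Y = _
  rw [braiding_naturality_left_assoc, braiding_tensorUnit_left, Category.assoc,
    Iso.inv_hom_id_assoc]
  rfl

lemma eHomWhiskerLeft_op {X Y : A} (f : X ⟶ Y) (Z : A) :
    eHomWhiskerLeft V (op Z) f.op = eHomWhiskerRight V f Z := by
  change (ρ_ (Y ⟶[V] Z)).inv ≫ (Y ⟶[V] Z) ◁ eHomEquiv V f ≫ (β_ _ _).hom ≫ eComp V X Y Z = _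
  rw [braiding_naturality_right_assoc, braiding_tensorUnit_right, Category.assoc,
    Iso.inv_hom_id_assoc]
  rfl

end Opposite

/-! ### Calculus of endomodules and of Tambara actions. -/

section Calculus

variable {V : Type u} [Category.{w} V] [MonoidalCategory V] [SymmetricCategory V]
  [MonoidalClosed V]
  {A : Type u₁} [Category.{v₁} A] [EnrichedOrdinaryCategory V A]

namespace Endomodule

variable (T : Endomodule V A)

/-- With one variable fixed, T is a V-functor out of A or Aᵒᵖ, so the laws for `mapHom` apply. The
same remark gives the functoriality and whiskering lemmas that follow. -/
lemma mapLeft_id (X Y : A) : T.mapLeft (𝟙 X) Y = 𝟙 _ :=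
  mapHom_id ((inclL Y).comp V T) (op X)

lemma mapRight_comp (X : A) {Y Y' Y'' : A} (f : Y ⟶ Y') (g : Y' ⟶ Y'') :
    T.mapRight X (f ≫ g) = T.mapRight X f ≫ T.mapRight X g :=
  mapHom_comp ((inclR (op X)).comp V T) f g

lemma mapLeft_comp {X'' X' X : A} (f : X'' ⟶ X') (g : X' ⟶ X) (Y : A) :
    T.mapLeft (f ≫ g) Y = T.mapLeft g Y ≫ T.mapLeft f Y :=
  mapHom_comp ((inclL Y).comp V T) g.op f.op

lemma right_post (X : A) {Y Z Z' : A} (g : Z ⟶ Z') :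
    T.right X Y Z ≫ eHomWhiskerLeft V _ (T.mapRight X g) = eHomWhiskerLeft V Y g ≫ T.right X Y Z' :=
  map_post ((inclR (op X)).comp V T) Y g

lemma right_pre (X : A) {Y Y' Z : A} (f : Y ⟶ Y') :
    T.right X Y' Z ≫ eHomWhiskerRight V (T.mapRight X f) _ =
      eHomWhiskerRight V f Z ≫ T.right X Y Z :=
  map_pre ((inclR (op X)).comp V T) f Z

lemma left_post {X'' X' : A} (f : X'' ⟶ X') (X Y : A) :
    T.left X' X Y ≫ eHomWhiskerLeft V _ (T.mapLeft f Y) =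
      eHomWhiskerRight V f X ≫ T.left X'' X Y := by
  rw [← eHomWhiskerLeft_op]
  exact map_post ((inclL Y).comp V T) (op X) f.op

lemma left_pre (X'' : A) {X' X : A} (f : X' ⟶ X) (Y : A) :
    T.left X'' X' Y ≫ eHomWhiskerRight V (T.mapLeft f Y) _ =
      eHomWhiskerLeft V X'' f ≫ T.left X'' X Y := by
  rw [← eHomWhiskerRight_op]
  exact map_pre ((inclL Y).comp V T) f.op (op X'')

lemma right_gcomp_left (X' X Y Y' : A) :
    gcomp (T.right X Y Y') (T.left X' X Y') =
      (β_ (Y ⟶[V] Y') (X' ⟶[V] X)).hom ≫ gcomp (T.left X' X Y) (T.right X' Y Y') :=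
  actR_gcomp_actL T (op X) (op X') Y Y'

lemma eHomEquiv_mapRight (X : A) {Y Y' : A} (g : Y ⟶ Y') :
    eHomEquiv V (T.mapRight X g) = eHomEquiv V g ≫ T.right X Y Y' :=
  Equiv.apply_symm_apply _ _

lemma eHomEquiv_mapLeft {X' X : A} (f : X' ⟶ X) (Y : A) :
    eHomEquiv V (T.mapLeft f Y) = eHomEquiv V f ≫ T.left X' X Y :=
  Equiv.apply_symm_apply _ _

/-- Bifunctoriality of T with the covariant argument specialised to a single morphism, where the
braiding becomes trivial. -/
lemma left_exchange (X' X : A) {Y Y' : A} (g : Y ⟶ Y') :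
    T.left X' X Y ≫ eHomWhiskerLeft V _ (T.mapRight X' g) =
      T.left X' X Y' ≫ eHomWhiskerRight V (T.mapRight X g) _ := by
  rw [comp_post, comp_pre, eHomEquiv_mapRight, eHomEquiv_mapRight, ← whiskerLeft_gcomp,
    ← whiskerRight_gcomp, right_gcomp_left, braiding_naturality_left_assoc,
    braiding_tensorUnit_left, Category.assoc, Iso.inv_hom_id_assoc]

lemma right_exchange {X' X : A} (f : X' ⟶ X) (Y Y' : A) :
    T.right X Y Y' ≫ eHomWhiskerLeft V _ (T.mapLeft f Y') =
      T.right X' Y Y' ≫ eHomWhiskerRight V (T.mapLeft f Y) _ := by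
  rw [comp_post, comp_pre, eHomEquiv_mapLeft, eHomEquiv_mapLeft, ← whiskerLeft_gcomp,
    ← whiskerRight_gcomp, right_gcomp_left, braiding_naturality_right_assoc,
    braiding_tensorUnit_right, Category.assoc, Iso.inv_hom_id_assoc]

lemma mapLeft_mapRight {X' X Y Y' : A} (f : X' ⟶ X) (g : Y ⟶ Y') :
    T.mapLeft f Y ≫ T.mapRight X' g = T.mapRight X g ≫ T.mapLeft f Y' := by
  apply (eHomEquiv V).injective
  rw [← hom_post, eHomEquiv_mapLeft, Category.assoc, left_exchange, ← Category.assoc,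
    ← eHomEquiv_mapLeft, hom_pre]

end Endomodule

namespace LeftTambara

variable [MonoidalCategory A] [MonoidalVCategory V A] (M : LeftTambara V A)

/-- The V-naturality axiom evaluated at the element of A(Y, Y') named by g. -/
lemma mapRight_act (B X : A) {Y Y' : A} (g : Y ⟶ Y') :
    M.T.mapRight X g ≫ M.act B X Y' = M.act B X Y ≫ M.T.mapRight (B ⊗ X) (B ◁ g) := by
  apply (eHomEquiv V).injective
  rw [← hom_post, Endomodule.eHomEquiv_mapRight, Category.assoc, natural_right,
    reassoc_of% eHomEquiv_wl, ← Category.assoc, ← Endomodule.eHomEquiv_mapRight, hom_pre]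

lemma mapLeft_act (B : A) {X' X : A} (f : X' ⟶ X) (Y : A) :
    M.T.mapLeft f Y ≫ M.act B X' Y = M.act B X Y ≫ M.T.mapLeft (B ◁ f) (B ⊗ Y) := by
  apply (eHomEquiv V).injective
  rw [← hom_post, Endomodule.eHomEquiv_mapLeft, Category.assoc, natural_left,
    reassoc_of% eHomEquiv_wl, ← Category.assoc, ← Endomodule.eHomEquiv_mapLeft, hom_pre]

end LeftTambara

end Calculus

/-! ### Naturality of the unitors in terms of one-sided tensoring. -/

section Unitor

variable (V : Type u) [Category.{w} V] [MonoidalCategory V] [BraidedCategory V]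
  {A : Type u₁} [Category.{v₁} A] [EnrichedOrdinaryCategory V A] [MonoidalCategory A]
  [MonoidalVCategory V A]

lemma wr_rightUnitor (X X' : A) :
    wr V X X' (𝟙_ A) ≫ eHomWhiskerLeft V _ (ρ_ X').hom = eHomWhiskerRight V (ρ_ X).hom _ := by
  have := MonoidalVCategory.rightUnitor_natural (V := V) X X'
  rw [← id_tensorHom, reassoc_of% tensorMap_eId, Iso.inv_hom_id_assoc, Category.id_comp] at this
  exact this

lemma wr_rightUnitor_inv (X X' : A) :
    wr V X X' (𝟙_ A) ≫ eHomWhiskerRight V (ρ_ X).inv _ = eHomWhiskerLeft V _ (ρ_ X').inv := by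
  have := congrArg (fun t => t ≫ eHomWhiskerRight V (ρ_ X).inv _ ≫
    eHomWhiskerLeft V _ (ρ_ X').inv) (wr_rightUnitor V X X')
  simp only [Category.assoc] at this
  rwa [← eHomWhiskerRight_comp_assoc, Iso.inv_hom_id, eHomWhiskerRight_id, Category.id_comp,
    eHom_whisker_exchange_assoc, ← eHomWhiskerLeft_comp, Iso.hom_inv_id, eHomWhiskerLeft_id,
    Category.comp_id] at this

lemma wl_leftUnitor (X X' : A) :
    wl V (𝟙_ A) X X' ≫ eHomWhiskerLeft V _ (λ_ X').hom = eHomWhiskerRight V (λ_ X).hom _ := by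
  have := MonoidalVCategory.leftUnitor_natural (V := V) X X'
  rw [← tensorHom_id, reassoc_of% eId_tensorMap, Iso.inv_hom_id_assoc, Category.id_comp] at this
  exact this

end Unitor

/-! ### The isomorphism of Y with its power by the unit object. -/

section PowUnit

variable (V : Type u) [Category.{w} V] [MonoidalCategory V] [BraidedCategory V]
  {A : Type u₁} [Category.{v₁} A] [EnrichedOrdinaryCategory V A] [MonoidalCategory A]
  [MonoidalVCategory V A] [RightClosed V A]

/-- The canonical isomorphism `Y ≅ Y ^ I`. -/
noncomputable def powUnit (Y : A) : Y ≅ pow V (𝟙_ A) Y where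
  hom := transposeHom V (λ_ Y).hom
  inv := (λ_ _).inv ≫ ev V (𝟙_ A) Y
  hom_inv_id := by
    rw [leftUnitor_inv_naturality_assoc, transposeHom_ev, Iso.inv_hom_id]
  inv_hom_id := by
    apply pow_hom_ext
    rw [MonoidalCategory.whiskerLeft_comp, Category.assoc, transposeHom_ev, leftUnitor_naturality,
      Iso.hom_inv_id_assoc, whiskerLeft_id, Category.id_comp]

/-- V-naturality of Y ≅ Y^I. After transposition the two sides become precomposition with the left
unitor of Y and tensoring by I followed by the left unitor of Y', which agree by V-naturality of
that unitor. -/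
lemma powR_powUnit (Y Y' : A) :
    powR V (𝟙_ A) Y Y' ≫ eHomWhiskerRight V (powUnit V Y).hom _ =
      eHomWhiskerLeft V _ (powUnit V Y').hom := by
  apply transpose_ext
  simp only [Category.assoc]
  rw [← reassoc_of% wl_pre, ← reassoc_of% wl_post, ← eHom_whisker_exchange,
    reassoc_of% powR_transpose, ← eHomWhiskerRight_comp, ← eHomWhiskerLeft_comp]
  -- Exposes `powUnit` as the transpose of the left unitor, so that evaluating cancels it.
  change eHomWhiskerRight V ((𝟙_ A) ◁ transposeHom V (λ_ Y).hom ≫ ev V _ _) _ =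
    wl V _ _ _ ≫ eHomWhiskerLeft V _ ((𝟙_ A) ◁ transposeHom V (λ_ Y').hom ≫ ev V _ _)
  rw [transposeHom_ev, transposeHom_ev, wl_leftUnitor]

end PowUnit

/-! ### The counit T(I, Y^X) → T(X, Y): naturality, compatibility with actions, invertibility. -/

section Counit

variable {V : Type u} [Category.{w} V] [MonoidalCategory V] [SymmetricCategory V]
  [MonoidalClosed V]
  {A : Type u₁} [Category.{v₁} A] [EnrichedOrdinaryCategory V A] [MonoidalCategory A]
  [MonoidalVCategory V A]

/-- The `V`-functor `T(I, -)`. -/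
def Endomodule.fiber (T : Endomodule V A) : EnrichedFunctor V A V :=
  (inclR (op (𝟙_ A))).comp V T

variable [RightClosed V A]

namespace LeftTambara

variable (M : LeftTambara V A)

/-- Naturality of the action in its covariant variable replaces the action of `powR` by that of B ⊗
`powR`; the evaluation inside β then absorbs it, since `powR` is defined by transposing
precomposition with evaluation. -/
lemma beta_natural_right (B X Y Y' : A) :
    powR V B Y Y' ≫ M.T.right X (pow V B Y) (pow V B Y') ≫ eHomWhiskerLeft V _ (M.beta B X Y') =
      M.T.right (B ⊗ X) Y Y' ≫ eHomWhiskerRight V (M.beta B X Y) _ := by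
  rw [beta, beta, eHomWhiskerLeft_comp, eHomWhiskerRight_comp, reassoc_of% M.natural_right,
    ← eHom_whisker_exchange, reassoc_of% Endomodule.right_post, reassoc_of% powR_transpose,
    reassoc_of% Endomodule.right_pre]

/-- V-naturality of β in the object B, which is an exponent on one side and a tensor factor on the
other. This is where the extraordinary naturality `natural_act` enters. -/
lemma beta_natural_left (B' B X Y : A) :
    powL V B' B Y ≫ M.T.right X (pow V B Y) (pow V B' Y) ≫ eHomWhiskerLeft V _ (M.beta B' X Y) =
      wr V B' B X ≫ M.T.left (B' ⊗ X) (B ⊗ X) Y ≫ eHomWhiskerRight V (M.beta B X Y) _ := by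
  rw [beta, beta, eHomWhiskerLeft_comp, eHomWhiskerRight_comp, reassoc_of% M.natural_right,
    -- The evaluation at B' turns `powL` into tensoring on the left variable followed by the
    -- evaluation at B. That evaluation is set aside so that `natural_act` can move the hom A(B', B)
    -- from the covariant to the contravariant slot, and is then commuted past the contravariant
    -- action.
    ← eHom_whisker_exchange, reassoc_of% Endomodule.right_post, reassoc_of% powL_transpose,
    ← reassoc_of% Endomodule.right_post, eHom_whisker_exchange, reassoc_of% M.natural_act,
    ← eHom_whisker_exchange, reassoc_of% Endomodule.left_exchange]

/-- The canonical map `T(I, Y ^ X) ⟶ T(X, Y)`. -/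
noncomputable def counitHom (X Y : A) : M.T.hom (𝟙_ A) (pow V X Y) ⟶ M.T.hom X Y :=
  M.beta X (𝟙_ A) Y ≫ M.T.mapLeft (ρ_ X).inv Y

lemma counitHom_natural_right (X Y Y' : A) :
    powR V X Y Y' ≫ M.T.right (𝟙_ A) (pow V X Y) (pow V X Y') ≫
        eHomWhiskerLeft V _ (M.counitHom X Y') =
      M.T.right X Y Y' ≫ eHomWhiskerRight V (M.counitHom X Y) _ := by
  rw [counitHom, counitHom, eHomWhiskerLeft_comp, eHomWhiskerRight_comp,
    reassoc_of% M.beta_natural_right, ← eHom_whisker_exchange,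
    reassoc_of% Endomodule.right_exchange]

/-- From `beta_natural_left`, A(X', X) acts through - ⊗ I; naturality of the right unitor converts
this to the plain action on X. -/
lemma counitHom_natural_left (X' X Y : A) :
    powL V X' X Y ≫ M.T.right (𝟙_ A) (pow V X Y) (pow V X' Y) ≫
        eHomWhiskerLeft V _ (M.counitHom X' Y) =
      M.T.left X' X Y ≫ eHomWhiskerRight V (M.counitHom X Y) _ := by
  rw [counitHom, counitHom, eHomWhiskerLeft_comp, eHomWhiskerRight_comp,
    reassoc_of% M.beta_natural_left, ← eHom_whisker_exchange,
    reassoc_of% Endomodule.left_post, reassoc_of% Endomodule.left_pre,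
    reassoc_of% wr_rightUnitor_inv]

/-- The counit at B ⊗ X uses the action by B ⊗ X on T(I, -), and `act_tensor` splits that into the
action by X, which forms the counit at X, followed by the action by B. The exponents match because
`coevPow` followed by evaluation is the associator followed by B ⊗ evaluation. -/
lemma counitHom_act (B X Y : A) :
    (cayleyTambara M.T.fiber).act B X Y ≫ M.counitHom (B ⊗ X) (B ⊗ Y) =
      M.counitHom X Y ≫ M.act B X Y := by
  change M.T.mapRight (𝟙_ A) (coevPow V B X Y) ≫ _ = _
  have h := congrArg (fun t => M.T.mapLeft (α_ B X (𝟙_ A)).hom _ ≫ t)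
    (M.T.mapLeft_comp (B ◁ (ρ_ X).inv) (α_ B X (𝟙_ A)).inv (B ⊗ Y))
  have e := M.act_tensor B X (𝟙_ A) (pow V X Y)
  -- The coherence that reconciles the associator produced by `act_tensor` with the right unitors in
  -- the two counits.
  have hρ : (ρ_ (B ⊗ X)).inv ≫ (α_ B X (𝟙_ A)).hom = B ◁ (ρ_ X).inv := by simp
  rw [counitHom, counitHom, beta, beta]
  simp only [Category.assoc]
  rw [reassoc_of% mapRight_act, ← reassoc_of% Endomodule.mapRight_comp, coevPow_ev,
    Endomodule.mapRight_comp, Category.assoc, reassoc_of% e, mapLeft_act,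
    reassoc_of% mapRight_act, reassoc_of% Endomodule.mapLeft_mapRight,
    ← Endomodule.mapLeft_comp, hρ]

instance isIso_mapLeft_inv (T : Endomodule V A) {X X' : A} (e : X ≅ X') (Y : A) :
    IsIso (T.mapLeft e.inv Y) :=
  ⟨T.mapLeft e.hom Y, by rw [← Endomodule.mapLeft_comp, Iso.hom_inv_id, Endomodule.mapLeft_id],
    by rw [← Endomodule.mapLeft_comp, Iso.inv_hom_id, Endomodule.mapLeft_id]⟩

/-- Strength is used in the counit only here, and only for β_l(X, I, Y); the remaining factor is T
of an inverse unitor. -/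
lemma isIso_counitHom (hM : M.IsStrong) (X Y : A) : IsIso (M.counitHom X Y) := by
  have := hM X (𝟙_ A) Y
  exact IsIso.comp_isIso

/-- Checked in each variable separately, where the actions of the Cayley module of T(I, -) are those
of T through `powL` and `powR`. -/
lemma isVNatural_counitHom :
    IsVNatural (F := cayleyObj M.T.fiber) (G := M.T)
      (fun p => eHomEquiv V (M.counitHom p.fst.unop p.snd)) := by
  refine isVNatural_eHomEquiv_of_actL_actR (F := cayleyObj M.T.fiber) (G := M.T)
    (fun p => M.counitHom p.fst.unop p.snd) (fun c c' d => ?_) (fun c d d' => ?_)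
  · refine (congrArg (· ≫ eHomWhiskerLeft V _ (M.counitHom c'.unop d))
      (cayleyObj_left M.T.fiber c'.unop c.unop d)).trans ((Category.assoc _ _ _).trans ?_)
    exact M.counitHom_natural_left c'.unop c.unop d
  · refine (congrArg (· ≫ eHomWhiskerLeft V _ (M.counitHom c.unop d'))
      (cayleyObj_right M.T.fiber c.unop d d')).trans ((Category.assoc _ _ _).trans ?_)
    exact M.counitHom_natural_right c.unop d d'

end LeftTambara

end Counit

/-! ### Building and lifting V-natural isomorphisms. -/

section NaturalIsomorphisms

variable {V : Type u} [Category.{w} V] [MonoidalCategory V] [SymmetricCategory V]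

/-- Lift a `V`-natural isomorphism along a `V`-functor which is monic on homs. -/
def VNatIso.lift {C : Type u₁} [EnrichedCategory V C] {D : Type u₂} [EnrichedCategory V D]
    {E : Type u₃} [EnrichedCategory V E] (U : EnrichedFunctor V D E)
    (hU : ∀ x y, Mono (U.map x y)) {F G : EnrichedFunctor V C D}
    (i : VNatIso (F.comp V U) (G.comp V U))
    (hom : ∀ c, 𝟙_ V ⟶ (F.obj c ⟶[V] G.obj c)) (inv : ∀ c, 𝟙_ V ⟶ (G.obj c ⟶[V] F.obj c))
    (hom_map : ∀ c, hom c ≫ U.map _ _ = i.hom c) (inv_map : ∀ c, inv c ≫ U.map _ _ = i.inv c) :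
    VNatIso F G where
  hom := hom
  inv := inv
  hom_natural c d := by
    -- Every law to be proved is an equation between maps into a hom-object of D, so it may be
    -- tested after applying U.
    have := hU (F.obj c) (G.obj d)
    rw [← cancel_mono (U.map _ _), Category.assoc, gcomp_map, gcomp_map, hom_map, hom_map]
    exact i.hom_natural c d
  inv_natural c d := by
    have := hU (G.obj c) (F.obj d)
    rw [← cancel_mono (U.map _ _), Category.assoc, gcomp_map, gcomp_map, inv_map, inv_map]
    exact i.inv_natural c d
  hom_inv c := by
    have := hU (F.obj c) (F.obj c)
    rw [← cancel_mono (U.map _ _), Category.assoc, gcomp_map, hom_map, inv_map, U.map_id]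
    exact i.hom_inv c
  inv_hom c := by
    have := hU (G.obj c) (G.obj c)
    rw [← cancel_mono (U.map _ _), Category.assoc, gcomp_map, hom_map, inv_map, U.map_id]
    exact i.inv_hom c

variable [MonoidalClosed V] [HasLimits V]
  {C : Type w} [EnrichedCategory V C] {D : Type u₂} [Category.{v} D] [EnrichedOrdinaryCategory V D]

/-- Naturality, in a variable indexing `V`-functors `C ⟶ D`, of elements given by morphisms
of `D`. -/
lemma isVNatural_natLift {X : Type u₁} [EnrichedCategory V X]
    {F G : EnrichedFunctor V X (EnrichedFunctor V C D)}
    (f : ∀ x c, (F.obj x).obj c ⟶ (G.obj x).obj c)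
    (hf : ∀ x, IsVNatural (F := F.obj x) (G := G.obj x) (fun c => eHomEquiv V (f x c)))
    (h : ∀ x y c, F.map x y ≫ pr _ _ c ≫ eHomWhiskerLeft V _ (f y c) =
      G.map x y ≫ pr _ _ c ≫ eHomWhiskerRight V (f x c) _) :
    IsVNatural (F := F) (G := G) (fun x => natLift _ (hf x)) := fun x y => natHom_ext fun c => by
  have e₁ : gcomp (F.map x y) (natLift _ (hf y)) ≫ pr _ _ c =
      gcomp (F.map x y ≫ pr _ _ c) (eHomEquiv V (f y c)) := by
    rw [gcomp, Category.assoc, eComp_pr, tensorHom_gcomp, natLift_pr]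
  have e₂ : gcomp (natLift _ (hf x)) (G.map x y) ≫ pr _ _ c =
      gcomp (eHomEquiv V (f x c)) (G.map x y ≫ pr _ _ c) := by
    rw [gcomp, Category.assoc, eComp_pr, tensorHom_gcomp, natLift_pr]
  have k := h x y c
  rw [← Category.assoc, ← Category.assoc, comp_post, comp_pre, Iso.inv_comp_eq] at k
  rw [Category.assoc, e₁, e₂, k, braiding_tensorUnit_right, Category.assoc]

lemma natLift_gcomp_natLift {F G : EnrichedFunctor V C D} (f : ∀ c, F.obj c ≅ G.obj c)
    (h : IsVNatural (F := F) (G := G) (fun c => eHomEquiv V (f c).hom))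
    (k : IsVNatural (F := G) (G := F) (fun c => eHomEquiv V (f c).inv)) :
    (λ_ (𝟙_ V)).inv ≫ gcomp (natLift _ h) (natLift _ k) = eId V F := natHom_ext fun c => by
  rw [gcomp, Category.assoc, Category.assoc, eComp_pr, tensorHom_gcomp, natLift_pr, natLift_pr,
    gcomp_eHomEquiv_iso, eId_pr]

/-- A `V`-natural isomorphism between `V`-functors into `[C, D]` from isomorphisms in `D`. -/
noncomputable def VNatIso.ofComponents {X : Type u₁} [EnrichedCategory V X]
    {F G : EnrichedFunctor V X (EnrichedFunctor V C D)}
    (f : ∀ x c, (F.obj x).obj c ≅ (G.obj x).obj c)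
    (hf : ∀ x, IsVNatural (F := F.obj x) (G := G.obj x) (fun c => eHomEquiv V (f x c).hom))
    (h : ∀ x y c, F.map x y ≫ pr _ _ c ≫ eHomWhiskerLeft V _ (f y c).hom =
      G.map x y ≫ pr _ _ c ≫ eHomWhiskerRight V (f x c).hom _) :
    VNatIso F G where
  hom x := natLift _ (hf x)
  inv x := natLift _ (isVNatural_eHomEquiv_inv (f x) (hf x))
  hom_natural := isVNatural_natLift (fun x c => (f x c).hom) hf h
  inv_natural := isVNatural_natLift (fun x c => (f x c).inv) _ fun x y c => by
    -- Naturality of the inverses in x: the hypothesis conjugated by the inverse components.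
    have := congrArg (fun t => t ≫ eHomWhiskerRight V (f x c).inv _ ≫
      eHomWhiskerLeft V _ (f y c).inv) (h x y c)
    simp only [Category.assoc] at this
    rw [← eHomWhiskerRight_comp_assoc, Iso.inv_hom_id, eHomWhiskerRight_id, Category.id_comp,
      eHom_whisker_exchange_assoc, ← eHomWhiskerLeft_comp, Iso.hom_inv_id, eHomWhiskerLeft_id,
      Category.comp_id] at this
    exact this.symm
  hom_inv x := natLift_gcomp_natLift (f x) (hf x) _
  inv_hom x := natLift_gcomp_natLift (fun c => (f x c).symm)
    (isVNatural_eHomEquiv_inv (f x) (hf x)) (hf x)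

end NaturalIsomorphisms

/-! ### Naturality of the counit in the Tambara module. -/

section Equivalence

variable {V : Type u} [Category.{w} V] [MonoidalCategory V] [SymmetricCategory V]
  [MonoidalClosed V] [HasLimits V]
  {A : Type w} [Category.{v₁} A] [EnrichedOrdinaryCategory V A]

section Projections

lemma pr_mapRight (T T' : Endomodule V A) (X : A) {Y Y' : A} (g : Y ⟶ Y') :
    T.pr T' X Y' ≫ eHomWhiskerRight V (T.mapRight X g) _ =
      T.pr T' X Y ≫ eHomWhiskerLeft V _ (T'.mapRight X g) := by
  -- V-naturality over the tensor product is restricted to the element (1, g).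
  have h := congrArg (fun t => (eHomEquiv V g ≫ inclRMap (op X) Y Y') ▷ _ ≫ t)
    (isVNatural_pr T T' ⟨op X, Y⟩ ⟨op X, Y'⟩)
  simp only [whiskerRight_gcomp, braiding_naturality_left_assoc, whiskerLeft_gcomp,
    Category.assoc] at h
  rw [comp_pre, comp_post, Endomodule.eHomEquiv_mapRight, Endomodule.eHomEquiv_mapRight]
  refine (congrArg ((λ_ _).inv ≫ ·) h).trans ?_
  rw [braiding_tensorUnit_left, Category.assoc, Iso.inv_hom_id_assoc]
  rfl

lemma pr_mapLeft (T T' : Endomodule V A) {X' X : A} (f : X' ⟶ X) (Y : A) :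
    T.pr T' X' Y ≫ eHomWhiskerRight V (T.mapLeft f Y) _ =
      T.pr T' X Y ≫ eHomWhiskerLeft V _ (T'.mapLeft f Y) := by
  have h := congrArg (fun t => (eHomEquiv V f ≫ inclLMap (op X) (op X') Y) ▷ _ ≫ t)
    (isVNatural_pr T T' ⟨op X, Y⟩ ⟨op X', Y⟩)
  simp only [whiskerRight_gcomp, braiding_naturality_left_assoc, whiskerLeft_gcomp,
    Category.assoc] at h
  rw [comp_pre, comp_post, Endomodule.eHomEquiv_mapLeft, Endomodule.eHomEquiv_mapLeft]
  refine (congrArg ((λ_ _).inv ≫ ·) h).trans ?_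
  rw [braiding_tensorUnit_left, Category.assoc, Iso.inv_hom_id_assoc]
  rfl

end Projections

variable [MonoidalCategory A] [MonoidalVCategory V A]

lemma LeftTambara.ι_compat (M N : LeftTambara V A) : Compat M N (ι M N) :=
  (compat_iff M N _).1 (equalizer.condition (homL M N) (homR M N))

variable [RightClosed V A]

namespace LeftTambara

/-- The counit is a composite of the action, T(1, e_r) and T(ρ⁻¹, 1). Elements of LTamb(M, N)
commute with the last two by V-naturality and with the first by the equalizer condition, so the
three factors are moved across one at a time, the last first. -/
lemma ι_counitHom (M N : LeftTambara V A) (X Y : A) :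
    ι M N ≫ M.T.pr N.T (𝟙_ A) (pow V X Y) ≫ eHomWhiskerLeft V _ (N.counitHom X Y) =
      ι M N ≫ M.T.pr N.T X Y ≫ eHomWhiskerRight V (M.counitHom X Y) _ := by
  rw [counitHom, counitHom, beta, beta]
  simp only [eHomWhiskerLeft_comp, eHomWhiskerRight_comp]
  rw [reassoc_of% pr_mapLeft, eHom_whisker_exchange_assoc, reassoc_of% pr_mapRight,
    eHom_whisker_exchange, eHom_whisker_exchange_assoc, reassoc_of% (ι_compat M N)]
  simp only [Category.assoc]

end LeftTambara

end Equivalence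

/-! ### The inverse V-functor and the two natural isomorphisms. -/

section Inverse

variable {V : Type u} [Category.{w} V] [MonoidalCategory V] [SymmetricCategory V]
  [MonoidalClosed V] [HasLimits V]
  {A : Type w} [Category.{v₁} A] [EnrichedOrdinaryCategory V A] [MonoidalCategory A]
  [MonoidalVCategory V A]

/-- Elements of `[Aᵒᵖ ⊗ A, V](T, T')` given by morphisms commuting with the actions are
compatible with the actions. -/
lemma LeftTambara.compat_of_act (M N : LeftTambara V A) (φ : 𝟙_ V ⟶ (M.T ⟶[V] N.T))
    (f : ∀ X Y, M.T.hom X Y ⟶ N.T.hom X Y)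
    (hφ : ∀ X Y, φ ≫ M.T.pr N.T X Y = eHomEquiv V (f X Y))
    (hf : ∀ B X Y, M.act B X Y ≫ f (B ⊗ X) (B ⊗ Y) = f X Y ≫ N.act B X Y) :
    Compat M N φ := fun B X Y => by
  rw [← Category.assoc, ← Category.assoc, hφ, hφ, hom_pre, hom_post, hf]

variable [RightClosed V A]

variable (V A) in
/-- The forgetful `V`-functor `LTamb_s(A) ⟶ [Aᵒᵖ ⊗ A, V]`. -/
noncomputable def StrongLeftTambara.forget :
    EnrichedFunctor V (StrongLeftTambara V A) (Endomodule V A) :=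
  StrongLeftTambara.inclusion.comp V LeftTambara.forget

lemma StrongLeftTambara.forget_map (M N : StrongLeftTambara V A) :
    (StrongLeftTambara.forget V A).map M N = LeftTambara.ι M.toLeftTambara N.toLeftTambara :=
  Category.id_comp _

lemma StrongLeftTambara.mono_forget_map (M N : StrongLeftTambara V A) :
    Mono ((StrongLeftTambara.forget V A).map M N) := by
  rw [StrongLeftTambara.forget_map]
  exact ⟨fun _ _ h => LeftTambara.hom_ext h⟩

variable (V A) in
/-- The `V`-functor `Φ : LTamb_s(A) ⟶ [A, V]` with `Φ(T) = T(I, -)`. -/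
noncomputable def fiberFunctor :
    EnrichedFunctor V (StrongLeftTambara V A) (EnrichedFunctor V A V) :=
  (StrongLeftTambara.forget V A).comp V (precompose (inclR (op (𝟙_ A))))

lemma fiberFunctor_map_pr (M N : StrongLeftTambara V A) (Y : A) :
    (fiberFunctor V A).map M N ≫ pr M.T.fiber N.T.fiber Y =
      LeftTambara.ι M.toLeftTambara N.toLeftTambara ≫ M.T.pr N.T (𝟙_ A) Y := by
  refine (Category.assoc _ _ _).trans ?_
  rw [StrongLeftTambara.forget_map]
  exact congrArg (LeftTambara.ι M.toLeftTambara N.toLeftTambara ≫ ·)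
    (precomposeMap_pr (inclR (op (𝟙_ A))) M.T N.T Y)

lemma cayleyHat_map_forget (F G : EnrichedFunctor V A V) :
    (cayleyHat V A).map F G ≫ (StrongLeftTambara.forget V A).map _ _ = (cayley V A).map F G := by
  rw [StrongLeftTambara.forget_map]
  exact cayleyHat_map_ι F G

/-- The isomorphism `F f : F X ≅ F Y` for a `V`-functor `F : A ⟶ V` and `f : X ≅ Y`. -/
def mapIso (F : EnrichedFunctor V A V) {X Y : A} (f : X ≅ Y) : F.obj X ≅ F.obj Y where
  hom := mapHom F f.hom
  inv := mapHom F f.inv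
  hom_inv_id := by rw [← mapHom_comp, Iso.hom_inv_id, mapHom_id]
  inv_hom_id := by rw [← mapHom_comp, Iso.inv_hom_id, mapHom_id]

variable (V A) in
/-- The `V`-natural isomorphism `1 ≅ Φ ∘ Υ̂`, with components `F(Y) ≅ F(Y ^ I)`. -/
noncomputable def cayleyUnit : VNatIso (EnrichedFunctor.id V (EnrichedFunctor V A V))
    ((cayleyHat V A).comp V (fiberFunctor V A)) :=
  VNatIso.ofComponents (F := EnrichedFunctor.id V (EnrichedFunctor V A V))
    (G := (cayleyHat V A).comp V (fiberFunctor V A))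
    (fun F Y => mapIso F (powUnit V Y))
    -- Naturality in Y: functoriality of F reduces it to the naturality of Y ≅ Y^I.
    (fun F => (isVNatural_eHomEquiv_iff (F := F) (G := (cayleyObj F).fiber)
      (fun Y => mapHom F (powUnit V Y).hom)).2 fun Y Y' => by
        have h : (cayleyObj F).fiber.map Y Y' = powR V (𝟙_ A) Y Y' ≫ F.map _ _ :=
          cayleyObj_right F (𝟙_ A) Y Y'
        refine (map_post F Y (powUnit V Y').hom).trans (Eq.trans ?_
          (congrArg (· ≫ eHomWhiskerRight V (mapHom F (powUnit V Y).hom) _) h).symm)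
        refine Eq.trans ?_ (Category.assoc _ _ _).symm
        change _ = powR V (𝟙_ A) Y Y' ≫ F.map _ _ ≫
          eHomWhiskerRight V (mapHom F (powUnit V Y).hom) (F.obj (pow V (𝟙_ A) Y'))
        rw [map_pre, ← Category.assoc, powR_powUnit])
    (fun F G Y => by
      -- Naturality in F: the Y-component of the composite on homs is the projection at Y^I, so what
      -- remains is naturality of the projections along Y ≅ Y^I.
      have h : ((cayleyHat V A).comp V (fiberFunctor V A)).map F G ≫
          pr (cayleyObj F).fiber (cayleyObj G).fiber Y = pr F G (pow V (𝟙_ A) Y) := by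
        refine (Category.assoc _ _ _).trans ((congrArg ((cayleyHat V A).map F G ≫ ·)
          (fiberFunctor_map_pr _ _ Y)).trans ((Category.assoc _ _ _).symm.trans ?_))
        refine (congrArg (· ≫ (cayleyObj F).pr (cayleyObj G) (𝟙_ A) Y)
          (cayleyHat_map_ι F G)).trans ?_
        exact precomposeMap_pr (powVFunctor V A) F G ⟨op (𝟙_ A), Y⟩
      refine (Category.id_comp _).trans ((pr_mapHom F G (powUnit V Y).hom).symm.trans ?_)
      exact (congrArg (· ≫ eHomWhiskerRight V (mapHom F (powUnit V Y).hom) _) h).symm.trans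
        (Category.assoc _ _ _))

/-- The isomorphism `T(I, Y ^ X) ≅ T(X, Y)` of a strong left Tambara module. -/
noncomputable def StrongLeftTambara.counitIso (M : StrongLeftTambara V A) (X Y : A) :
    M.T.hom (𝟙_ A) (pow V X Y) ≅ M.T.hom X Y :=
  @asIso _ _ _ _ (M.counitHom X Y) (M.isIso_counitHom M.isStrong X Y)

variable (V A) in
/-- The `V`-natural isomorphism underlying `Υ̂ ∘ Φ ≅ 1`. -/
noncomputable def forgetCounit :
    VNatIso (((fiberFunctor V A).comp V (cayleyHat V A)).comp V (StrongLeftTambara.forget V A))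
      ((EnrichedFunctor.id V (StrongLeftTambara V A)).comp V (StrongLeftTambara.forget V A)) :=
  VNatIso.ofComponents
    (F := ((fiberFunctor V A).comp V (cayleyHat V A)).comp V (StrongLeftTambara.forget V A))
    (G := (EnrichedFunctor.id V (StrongLeftTambara V A)).comp V (StrongLeftTambara.forget V A))
    (fun M p => M.counitIso p.fst.unop p.snd)
    (fun M => M.isVNatural_counitHom)
    (fun M N p => by
      obtain ⟨⟨X⟩, Y⟩ := p
      -- The (X, Y)-component of a Cayley image is the component at Y^X, and Φ restricts to first
      -- index I. The composite thus projects to (I, Y^X), the form in which `ι_counitHom` applies.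
      have h₁ : (((fiberFunctor V A).comp V (cayleyHat V A)).comp V
          (StrongLeftTambara.forget V A)).map M N ≫
            pr (cayleyObj M.T.fiber) (cayleyObj N.T.fiber) ⟨op X, Y⟩ =
          LeftTambara.ι M.toLeftTambara N.toLeftTambara ≫ M.T.pr N.T (𝟙_ A) (pow V X Y) := by
        refine Eq.trans ?_ (fiberFunctor_map_pr M N (pow V X Y))
        refine (congrArg (· ≫ pr (cayleyObj M.T.fiber) (cayleyObj N.T.fiber) ⟨op X, Y⟩)
          ((Category.assoc _ _ _).trans (congrArg ((fiberFunctor V A).map M N ≫ ·)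
            (cayleyHat_map_forget M.T.fiber N.T.fiber)))).trans ?_
        refine (Category.assoc _ _ _).trans ?_
        exact congrArg ((fiberFunctor V A).map M N ≫ ·)
          (precomposeMap_pr (powVFunctor V A) M.T.fiber N.T.fiber ⟨op X, Y⟩)
      have h₂ : ((EnrichedFunctor.id V (StrongLeftTambara V A)).comp V
          (StrongLeftTambara.forget V A)).map M N =
            LeftTambara.ι M.toLeftTambara N.toLeftTambara :=
        (Category.id_comp _).trans (StrongLeftTambara.forget_map M N)
      refine (Category.assoc _ _ _).symm.trans ((congrArg
        (· ≫ eHomWhiskerLeft V _ (N.counitHom X Y)) h₁).trans ((Category.assoc _ _ _).trans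
          ((LeftTambara.ι_counitHom M.toLeftTambara N.toLeftTambara X Y).trans ?_)))
      exact (congrArg (· ≫ M.T.pr N.T X Y ≫ eHomWhiskerRight V (M.counitHom X Y) _) h₂).symm)

/-- The components commute with the actions by `counitHom_act`, so the isomorphism of endomodules
factors through the equalizer defining LTamb. -/
lemma forgetCounit_hom_compat (M : StrongLeftTambara V A) :
    LeftTambara.Compat (cayleyTambara M.T.fiber) M.toLeftTambara ((forgetCounit V A).hom M) :=
  LeftTambara.compat_of_act (cayleyTambara M.T.fiber) M.toLeftTambara ((forgetCounit V A).hom M)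
    (fun X Y => (M.counitIso X Y).hom)
    (fun X Y => natLift_pr (F := cayleyObj M.T.fiber) (G := M.T) _
      M.isVNatural_counitHom ⟨op X, Y⟩)
    (fun B X Y => M.counitHom_act B X Y)

lemma forgetCounit_inv_compat (M : StrongLeftTambara V A) :
    LeftTambara.Compat M.toLeftTambara (cayleyTambara M.T.fiber) ((forgetCounit V A).inv M) :=
  LeftTambara.compat_of_act M.toLeftTambara (cayleyTambara M.T.fiber) ((forgetCounit V A).inv M)
    (fun X Y => (M.counitIso X Y).inv)
    (fun X Y => natLift_pr (F := M.T) (G := cayleyObj M.T.fiber) _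
      (isVNatural_eHomEquiv_inv (F := cayleyObj M.T.fiber) (G := M.T)
        (fun p => M.counitIso p.fst.unop p.snd) M.isVNatural_counitHom) ⟨op X, Y⟩)
    (fun B X Y => by
      -- No new computation for the inverses: cancelling them on both sides returns `counitHom_act`.
      refine (Iso.comp_inv_eq (M.counitIso (B ⊗ X) (B ⊗ Y))).2 ?_
      refine Eq.trans ?_ (Category.assoc _ _ _).symm
      exact (Iso.eq_inv_comp (M.counitIso X Y)).2 (M.counitHom_act B X Y).symm)

variable (V A) in
/-- The `V`-natural isomorphism `Υ̂ ∘ Φ ≅ 1`. -/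
noncomputable def cayleyCounit : VNatIso ((fiberFunctor V A).comp V (cayleyHat V A))
    (EnrichedFunctor.id V (StrongLeftTambara V A)) :=
  VNatIso.lift (StrongLeftTambara.forget V A) StrongLeftTambara.mono_forget_map
    (forgetCounit V A)
    (fun M => LeftTambara.lift ((forgetCounit V A).hom M) (forgetCounit_hom_compat M))
    (fun M => LeftTambara.lift ((forgetCounit V A).inv M) (forgetCounit_inv_compat M))
    (fun M => (congrArg (_ ≫ ·) (StrongLeftTambara.forget_map _ _)).trans
      (LeftTambara.lift_ι _ (forgetCounit_hom_compat M)))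
    (fun M => (congrArg (_ ≫ ·) (StrongLeftTambara.forget_map _ _)).trans
      (LeftTambara.lift_ι _ (forgetCounit_inv_compat M)))

end Inverse

end Tambara

theorem mainTheorem4 {V : Type u} [Category.{w} V] [MonoidalCategory V] [SymmetricCategory V]
    [MonoidalClosed V] [HasLimits V] [HasColimits V] {A : Type w} [Category.{v₁} A]
    [EnrichedOrdinaryCategory V A] [MonoidalCategory A] [Tambara.MonoidalVCategory V A]
    [Tambara.RightClosed V A] :
    Tambara.IsVEquivalence (Tambara.cayleyHat V A) :=
  ⟨Tambara.fiberFunctor V A, ⟨Tambara.cayleyUnit V A⟩, ⟨Tambara.cayleyCounit V A⟩⟩
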